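/- **Rewards.** A *barycentric algebra* is a set $A$ with operations $+_p : A^2\to A$ ($p\in[0,1]$) satisfying $x+_1y=x$, $x+_px=x$, $x+_py=y+_{1-p}x$ and $(x+_py)+_qz=x+_{pq}(y+_{\frac{(1-p)q}{1-pq}}z)$ for $p,q<1$; iterating these operations one has finite convex combinations $\sum_i p_ix_i$ in $A$. Let $R$ be a barycentric algebra with a commutative monoid structure $(+,0)$ such that $r+(s+_ps')=(r+s)+_p(r+s')$, and with a total order such that $r\le s\iff r+_pt\le s+_pt$ ($0<p<1$) and $r\le s\iff r+t\le s+t$. A *barycentric $R$-module* is a barycentric algebra with unary operations $r\cdot-$ ($r\in R$) such that $0\cdot x=x$, $r\cdot(s\cdot x)=(r+s)\cdot x$ and $r\cdot(x+_py)=r\cdot x+_pr\cdot y$. Let $\Pr(X)$ be the set of finitely supported probability distributions on $X$, and $\mathrm{DW}(X)=\Pr(R\times X)$. **Language.** Types are $\sigma ::= b\mid\mathtt{Unit}\mid\sigma\times\sigma\mid\sigma\to\sigma$, with base types $b$ that include $\mathtt{Bool}$ and $\mathtt{Rew}$. Terms are those of the simply typed call-by-value $\lambda$-calculus (variables, abstraction,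 application, $\ast$, pairs, projections) with constants $c:b$ (including $\mathtt{tt},\mathtt{ff}:\mathtt{Bool}$ and $0:\mathtt{Rew}$), applications $f(M_1,\dots,M_m)$ of first-order function symbols (including $=_b$, $+$, $\le$ and $\oplus_p$), conditionals, and the operations $M\,\mathtt{or}\,N$, $N\cdot M$ (with $N:\mathtt{Rew}$) and $M+_pN$ ($p\in[0,1]$). Programs are closed well-typed terms; values are constants, $\ast$, pairs of values and closed abstractions; $\mathrm{Val}_\sigma$ is the set of values of type $\sigma$. A constant $\mathrm{val}_f(c_1,\dots,c_m)$ is given for each function symbol $f$ and constants $c_i$ of the right types, with $\mathrm{val}_{=_b}$ the equality test. A semantics of the vocabulary is given: nonempty sets $[\![b]\!]$ with $[\![\mathtt{Bool}]\!]=\{0,1\}$, $[\![\mathtt{Rew}]\!]=R$; elements $[\![c]\!]\in[\![b]\!]$, distinct for distinct constants of the same type, with $[\![\mathtt{tt}]\!]=1$, $[\![\mathtt{ff}]\!]=0$, $[\![0]\!]=0$ and $[\![c]\!]\ne0$ for some $c:\mathtt{Rew}$; and functions $[\![f]\!]$ with $[\![f]\!]([\![c_1]\!],\dots,[\![c_m]\!])=[\![\mathrm{val}_f(c_1,\dots,c_m)]\!]$,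 where $+,\le,\oplus_p$ denote the addition, the order and the operation $+_p$ of $R$. **Operational semantics.** Programs are reduced by the usual left-to-right call-by-value small-step semantics with evaluation contexts. An *effect value* is built from values by $E_1\,\mathtt{or}\,E_2$, $c\cdot E$ and $E_1+_pE_2$. The effect value $\mathrm{Op}(M)$ of a program $M$ is $V$ if $M$ reduces to the value $V$; otherwise $M$ reduces to some $\mathcal E[op(\vec c;M_1,\dots,M_m)]$ with $op$ one of the three operations, and $\mathrm{Op}(M)=op(\vec c;\mathrm{Op}(\mathcal E[M_1]),\dots,\mathrm{Op}(\mathcal E[M_m]))$. The strategies of an effect value are: one strategy $\ast$ for a value $V$; $1s$ and $2s'$ for $E_1\,\mathtt{or}\,E_2$, with $s$ a strategy of $E_1$ and $s'$ of $E_2$, those of the form $1s$ coming first; the strategies of $E$ for $c\cdot E$; and the pairs $(s_1,s_2)$ of strategies of $E_1$ and $E_2$, ordered lexicographically, for $E_1+_pE_2$. Their outcomes in $\mathrm{DW}(\mathrm{Val}_\sigma)$ are $\mathrm{Out}(\ast,V)=\delta_{(0,V)}$, $\mathrm{Out}(is,E_1\,\mathtt{or}\,E_2)=\mathrm{Out}(s,E_i)$,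 $\mathrm{Out}((s_1,s_2),E_1+_pE_2)=p\,\mathrm{Out}(s_1,E_1)+(1-p)\,\mathrm{Out}(s_2,E_2)$, and $\mathrm{Out}(s,c\cdot E)$ is $\mathrm{Out}(s,E)$ with $[\![c]\!]$ added to all rewards. The expected reward of $\sum_ip_i(r_i,V_i)$ is $\sum_ip_ir_i\in R$. Finally $\mathrm{Op}_s(M)=\mathrm{Out}(s_{\mathrm{opt}},\mathrm{Op}(M))$, where $s_{\mathrm{opt}}$ is the least of the strategies of $\mathrm{Op}(M)$ whose outcome has maximal expected reward. **Denotational semantics.** Let $T$ be a monad on sets with generic effects $g_{\mathrm{rew}}:R\to T([1])$ and $g_{+_p}\in T([2])$ ($p\in[0,1]$), corresponding algebraic operations $r\cdot-:T(X)\to T(X)$ and $+_p:T(X)^2\to T(X)$, and a $T$-algebra $\alpha:T(R)\to R$, such that: * (A1) these operations make every $T(X)$ a barycentric $R$-module; * (A2) $\alpha(r\cdot x)=r+\alpha(x)$ and $\alpha(x+_py)=\alpha(x)+_p\alpha(y)$. For $u\in T(X)$ and $\gamma:X\to R$ put $\mathbf R(u|\gamma)=\alpha(T(\gamma)(u))$.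 The selection monad $\mathcal S(X)=(X\to R)\to T(X)$ has unit $\eta(x)(\gamma)=\eta_T(x)$ and Kleisli extension $f^\dagger(F)(\gamma)=(\lambda x.\,f(x)(\gamma))^{\dagger_T}\big(F(\lambda x.\,\mathbf R(f(x)(\gamma)|\gamma))\big)$. The denotation $[\![M]\!]\in\mathcal S([\![\sigma]\!])$ of a program $M:\sigma$, and the effect-free denotation $[\![V]\!]_p\in[\![\sigma]\!]$ of a value $V:\sigma$, are given by the standard left-to-right call-by-value semantics in $\mathcal S$ (with $[\![\sigma\to\tau]\!]=[\![\sigma]\!]\to\mathcal S([\![\tau]\!])$), where reward and $+_p$ act pointwise in $\gamma$, and $\mathtt{or}(F,G)(\gamma)$ is $F\gamma$ if $\mathbf R(F\gamma|\gamma)\ge\mathbf R(G\gamma|\gamma)$ and $G\gamma$ otherwise. For $\mu=\sum_ip_i(r_i,V_i)\in\mathrm{DW}(\mathrm{Val}_\sigma)$ put $[\![\mu]\!]_T=\sum_ip_i\,(r_i\cdot\eta_T([\![V_i]\!]_p))\in T([\![\sigma]\!])$. **Theorem (Selection adequacy).** Every program $M:\sigma$ has exactly one effect value $\mathrm{Op}(M)$,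 and for every $T$ as above, $$[\![M]\!](0)=[\![\mathrm{Op}_s(M)]\!]_T ,$$ where $0$ is the zero reward function on $[\![\sigma]\!]$. Moreover the following, with their evident generic effects, are monads that satisfy all the assumptions on $T$ (so that the equation holds for them), where $f^\dagger:T_i(X)\to A$ extends $f:X\to A$, and $\alpha=\mathrm{id}_R^\dagger$ for the module $R$ with $r\cdot s=r+s$: * $T_1=\mathrm{DW}$, with unit $x\mapsto\delta_{(0,x)}$ and $f^\dagger(\sum_ip_i(r_i,x_i))=\sum_ip_i(r_i\cdot f(x_i))$; * $T_2(X)=\{(\mu,\rho)\mid\mu\in\Pr(X),\ \rho:\mathrm{supp}(\mu)\to R\}$, with unit $x\mapsto(\delta_x,\,x\mapsto0)$, $f^\dagger(\mu,\rho)=\sum_x\mu(x)(\rho(x)\cdot f(x))$, $r\cdot(\mu,\rho)=(\mu,r+\rho)$ and $(\mu,\rho)+_p(\mu',\rho')=(\nu,\rho'')$, where $\nu=p\mu+(1-p)\mu'$ and $\rho''(x)$ is the convex combination of $\rho(x)$ and $\rho'(x)$ with weights $p\mu(x)/\nu(x)$ and $(1-p)\mu'(x)/\nu(x)$ (omitting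 a term of weight zero); * provided that $(r+x)+_p(s+y)=((r+_ps)+x)+_p((r+_ps)+y)$ holds in $R$, $T_3(X)=\Pr(X)\times R$, with unit $x\mapsto(\delta_x,0)$, $f^\dagger(\sum_ip_ix_i,r)=r\cdot\sum_ip_if(x_i)$, $r\cdot(\mu,s)=(\mu,r+s)$ and $(\mu,r)+_p(\nu,s)=(p\mu+(1-p)\nu,\,r+_ps)$. -/

import Mathlib

/-! A call-by-value lambda-calculus with choice, rewards and probabilistic choice: its terms,
its (selection) operational semantics, and its denotational semantics in the selection monad
augmented with an auxiliary monad. -/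

universe u v

namespace SelLang

open Convexity

/-- The set `[0,1]` of probabilities. -/
abbrev Prob : Type := unitInterval

/-! ### Barycentric algebras and rewards -/

/-- The equations of barycentric algebras. In the last one `s` is `(1 - p) q / (1 - p q)`. -/
structure IsBarycentric {A : Type*} (comb : Prob → A → A → A) : Prop where
  comb_one : ∀ x y, comb 1 x y = x
  comb_self : ∀ p x, comb p x x = x
  comb_symm : ∀ p x y, comb p x y = comb (unitInterval.symm p) y x
  comb_assoc : ∀ (p q s : Prob) (x y z : A), p < 1 → q < 1 →
    (s : ℝ) = (1 - p) * q / (1 - p * q) →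
    comb q (comb p x y) z = comb (p * q) x (comb s y z)

/-- Sets of rewards: totally ordered barycentric commutative monoids, whose addition and
proper probabilistic choices preserve and reflect the order. `pc p r s` is `r +_p s`. -/
class RewardSpace (R : Type u) extends AddCommMonoid R, LinearOrder R where
  pc : Prob → R → R → R
  barycentric : IsBarycentric pc
  add_pc : ∀ (p : Prob) (r s s' : R), r + pc p s s' = pc p (r + s) (r + s')
  le_iff_pc_le : ∀ (p : Prob) (r s t : R), 0 < p → p < 1 → (r ≤ s ↔ pc p r t ≤ pc p s t)
  le_iff_add_le : ∀ r s t : R, r ≤ s ↔ r + t ≤ s + t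

/-- Barycentric `R`-modules: an action of the monoid `R` that distributes over the
probabilistic choices of a barycentric algebra. -/
structure IsBarycentricModule (R : Type u) [RewardSpace R] {A : Type*}
    (act : R → A → A) (comb : Prob → A → A → A) : Prop where
  barycentric : IsBarycentric comb
  zero_act : ∀ x, act 0 x = x
  act_act : ∀ r s x, act r (act s x) = act (r + s) x
  act_comb : ∀ r p x y, act r (comb p x y) = comb p (act r x) (act r y)

/-- The normalized weighted mean of the points `f z`, for `z` in a nonempty list, with weights
`w z`: iterated binary convex combination. (The quotient of weights is in `[0,1]` whenever
the weights are nonnegative, and then `Set.projIcc` does not change it.) -/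
noncomputable def listMean {A Z : Type*} (comb : Prob → A → A → A) (w : Z → ℝ) (f : Z → A) :
    (l : List Z) → l ≠ [] → A
  | [], h => absurd rfl h
  | [z], _ => f z
  | z :: y :: l, _ =>
      comb (Set.projIcc (0 : ℝ) 1 zero_le_one (w z / ((z :: y :: l).map w).sum)) (f z)
        (listMean comb w f (y :: l) (List.cons_ne_nil y l))

theorem support_toList_ne_nil {Z : Type*} (μ : StdSimplex ℝ Z) :
    μ.weights.support.toList ≠ [] := by
  have h := μ.support_weights_nonempty
  intro h'
  rw [Finset.toList_eq_nil] at h'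
  simp [h'] at h

/-- The convex combination `∑ z, μ z • f z` in a barycentric algebra, for a finitely supported
probability distribution `μ`. (By the equations of barycentric algebras it does not depend on
the enumeration of the support.) -/
noncomputable def convexSum {A Z : Type*} (comb : Prob → A → A → A) (μ : StdSimplex ℝ Z)
    (f : Z → A) : A :=
  listMean comb μ.weights f μ.weights.support.toList (support_toList_ne_nil μ)

/-- The mixture `p μ + (1 - p) ν` of two finite probability distributions. -/
noncomputable def mix {Z : Type*} (p : Prob) (μ ν : StdSimplex ℝ Z) : StdSimplex ℝ Z :=
  convexCombPair (p : ℝ) (1 - p) p.2.1 (sub_nonneg.2 p.2.2) (add_sub_cancel _ _) μ ν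

/-! ### The distribution-writer functor -/

/-- `DW(X)`: finite probability distributions on `R × X`. -/
abbrev DW (R : Type u) (X : Type v) : Type (max u v) := StdSimplex ℝ (R × X)

/-- `r · μ`: adds `r` to all rewards. -/
noncomputable def DW.act {R : Type u} [RewardSpace R] {X : Type v} (r : R) (μ : DW R X) :
    DW R X :=
  StdSimplex.map (fun z => (r + z.1, z.2)) μ

/-- The extension of `f : X → A` to `DW(X)`, sending `∑ pᵢ (rᵢ, xᵢ)` to `∑ pᵢ (rᵢ · f xᵢ)`. -/
noncomputable def DW.extend {R : Type u} {X : Type v} {A : Type*} (act : R → A → A)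
    (comb : Prob → A → A → A) (f : X → A) (μ : DW R X) : A :=
  convexSum comb μ (fun z => act z.1 (f z.2))

/-- The expected reward `∑ pᵢ rᵢ` of `∑ pᵢ (rᵢ, xᵢ)`. -/
noncomputable def DW.expect {R : Type u} [RewardSpace R] {X : Type v} (μ : DW R X) : R :=
  convexSum RewardSpace.pc μ Prod.fst

/-! ### Auxiliary monads -/

/-- The data that an auxiliary monad `T` carries: generic effects for reward and for the
probabilistic choices (with `[1]` and `[2]` as `PUnit` and `ULift (Fin 2)`), and a map
`α : T(R) → R`. -/
structure AuxData (R : Type u) (T : Type u → Type u) where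
  genReward : R → T PUnit.{u + 1}
  genProb : Prob → T (ULift.{u} (Fin 2))
  alg : T R → R

section Aux

variable {R : Type u} [RewardSpace R] {T : Type u → Type u} [Monad T]

/-- The algebraic operation of the generic effect for reward. -/
def AuxData.reward (A : AuxData R T) {X : Type u} (r : R) (x : T X) : T X :=
  A.genReward r >>= fun _ => x

/-- The algebraic operation of the generic effect for probabilistic choice. -/
def AuxData.prob (A : AuxData R T) {X : Type u} (p : Prob) (x y : T X) : T X :=
  A.genProb p >>= fun i => if i.down = 0 then x else y

/-- `α` is a `T`-algebra; (A1) the operations make every `T(X)` a barycentric `R`-module;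
(A2) `α` is a homomorphism of barycentric `R`-modules. -/
structure AuxData.IsAuxiliary (A : AuxData R T) : Prop where
  alg_pure : ∀ r : R, A.alg (pure r) = r
  alg_join : ∀ t : T (T R), A.alg (t >>= id) = A.alg (A.alg <$> t)
  isModule : ∀ X : Type u,
    IsBarycentricModule R (A := T X) (fun r x => A.reward r x) (fun p x y => A.prob p x y)
  alg_reward : ∀ (r : R) (x : T R), A.alg (A.reward r x) = r + A.alg x
  alg_prob : ∀ (p : Prob) (x y : T R),
    A.alg (A.prob p x y) = RewardSpace.pc p (A.alg x) (A.alg y)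

/-! ### The selection monad augmented with an auxiliary monad -/

/-- `S_T(X) = (X → R) → T(X)`. -/
abbrev Sel (R : Type u) (T : Type u → Type u) (X : Type u) : Type u := (X → R) → T X

/-- `R(x | γ) = α(T(γ)(x))`, the reward of `x ∈ T(X)` given the reward function `γ`. -/
def AuxData.rewardOf (A : AuxData R T) {X : Type u} (x : T X) (γ : X → R) : R :=
  A.alg (γ <$> x)

def selPure {X : Type u} (x : X) : Sel R T X := fun _ => pure x

/-- Kleisli extension of `f`, applied to `F`. -/
def AuxData.selBind (A : AuxData R T) {X Y : Type u} (F : Sel R T X) (f : X → Sel R T Y) :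
    Sel R T Y :=
  fun γ => F (fun x => A.rewardOf (f x γ) γ) >>= fun x => f x γ

/-- Evaluate finitely many computations from left to right. -/
def AuxData.selSeq (A : AuxData R T) : {n : ℕ} → {X : Fin n → Type u} →
    (∀ i, Sel R T (X i)) → Sel R T (∀ i, X i)
  | 0, _, _ => selPure (fun i => i.elim0)
  | _ + 1, _, F => A.selBind (F 0) fun x =>
      A.selBind (A.selSeq fun i => F i.succ) fun xs => selPure (Fin.cons x xs)

def AuxData.selOr (A : AuxData R T) {X : Type u} (F G : Sel R T X) : Sel R T X :=
  fun γ => if A.rewardOf (F γ) γ ≥ A.rewardOf (G γ) γ then F γ else G γ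

def AuxData.selReward (A : AuxData R T) {X : Type u} (r : R) (F : Sel R T X) : Sel R T X :=
  fun γ => A.reward r (F γ)

def AuxData.selProb (A : AuxData R T) {X : Type u} (p : Prob) (F G : Sel R T X) : Sel R T X :=
  fun γ => A.prob p (F γ) (G γ)

end Aux

/-! ### Types, vocabularies and terms -/

inductive BaseTy (B : Type v) : Type v
  | bool
  | rew
  | other (b : B)

inductive Ty (B : Type v) : Type v
  | base (b : BaseTy B)
  | unit
  | prod (σ τ : Ty B)
  | arrow (σ τ : Ty B)

/-- A basic vocabulary: base types besides `Bool` and `Rew`, constants (including `tt`, `ff`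
and `0`), and function symbols besides the ones that every vocabulary has. -/
structure Vocabulary where
  B : Type v
  Con : BaseTy B → Type v
  tt : Con .bool
  ff : Con .bool
  zero : Con .rew
  F : Type v
  arity : F → ℕ
  dom : ∀ f : F, Fin (arity f) → BaseTy B
  cod : F → BaseTy B

/-- Function symbols: equalities `=_b`, `+`, `≤`, `⊕_p`, and the others. -/
inductive FnSym (V : Vocabulary.{v}) : Type v
  | eq (b : BaseTy V.B)
  | add
  | le
  | oplus (p : Prob)
  | other (f : V.F)

namespace FnSym

variable {V : Vocabulary.{v}}

@[reducible]
def arity : FnSym V → ℕ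
  | eq _ => 2
  | add => 2
  | le => 2
  | oplus _ => 2
  | other f => V.arity f

@[reducible]
def dom : (f : FnSym V) → Fin f.arity → BaseTy V.B
  | eq b, _ => b
  | add, _ => .rew
  | le, _ => .rew
  | oplus _, _ => .rew
  | other f, i => V.dom f i

@[reducible]
def cod : FnSym V → BaseTy V.B
  | eq _ => .bool
  | add => .rew
  | le => .bool
  | oplus _ => .rew
  | other f => V.cod f

end FnSym

/-- Evaluation functions `val_f` on constants, for the function symbols `f`. -/
structure FnEval (V : Vocabulary.{v}) where
  val : ∀ f : FnSym V, (∀ i, V.Con (f.dom i)) → V.Con f.cod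
  val_eq_tt : ∀ (b : BaseTy V.B) (c : Fin 2 → V.Con b), c 0 = c 1 → val (.eq b) c = V.tt
  val_eq_ff : ∀ (b : BaseTy V.B) (c : Fin 2 → V.Con b), c 0 ≠ c 1 → val (.eq b) c = V.ff

/-- Variables, as typed de Bruijn indices. -/
inductive Var {B : Type v} : List (Ty B) → Ty B → Type v
  | zero {Γ : List (Ty B)} {σ : Ty B} : Var (σ :: Γ) σ
  | succ {Γ : List (Ty B)} {σ τ : Ty B} (x : Var Γ σ) : Var (τ :: Γ) σ

/-- Well-typed terms in context, up to renaming of bound variables. -/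
inductive Tm (V : Vocabulary.{v}) : List (Ty V.B) → Ty V.B → Type v
  | var {Γ : List (Ty V.B)} {σ : Ty V.B} (x : Var Γ σ) : Tm V Γ σ
  | con {Γ : List (Ty V.B)} {b : BaseTy V.B} (c : V.Con b) : Tm V Γ (.base b)
  | fn {Γ : List (Ty V.B)} (f : FnSym V) (M : ∀ i, Tm V Γ (.base (f.dom i))) :
      Tm V Γ (.base f.cod)
  | ite {Γ : List (Ty V.B)} {σ : Ty V.B} (L : Tm V Γ (.base .bool)) (M N : Tm V Γ σ) : Tm V Γ σ
  | or {Γ : List (Ty V.B)} {σ : Ty V.B} (M N : Tm V Γ σ) : Tm V Γ σ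
  | reward {Γ : List (Ty V.B)} {σ : Ty V.B} (N : Tm V Γ (.base .rew)) (M : Tm V Γ σ) : Tm V Γ σ
  | prob {Γ : List (Ty V.B)} {σ : Ty V.B} (p : Prob) (M N : Tm V Γ σ) : Tm V Γ σ
  | star {Γ : List (Ty V.B)} : Tm V Γ .unit
  | pair {Γ : List (Ty V.B)} {σ τ : Ty V.B} (M : Tm V Γ σ) (N : Tm V Γ τ) : Tm V Γ (.prod σ τ)
  | fst {Γ : List (Ty V.B)} {σ τ : Ty V.B} (M : Tm V Γ (.prod σ τ)) : Tm V Γ σ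
  | snd {Γ : List (Ty V.B)} {σ τ : Ty V.B} (M : Tm V Γ (.prod σ τ)) : Tm V Γ τ
  | lam {Γ : List (Ty V.B)} {σ τ : Ty V.B} (M : Tm V (σ :: Γ) τ) : Tm V Γ (.arrow σ τ)
  | app {Γ : List (Ty V.B)} {σ τ : Ty V.B} (M : Tm V Γ (.arrow σ τ)) (N : Tm V Γ σ) : Tm V Γ τ

/-- Programs are the closed well-typed terms. -/
abbrev Program (V : Vocabulary.{v}) (σ : Ty V.B) : Type v := Tm V [] σ

section Subst

variable {V : Vocabulary.{v}}

def Ren (V : Vocabulary.{v}) (Γ Δ : List (Ty V.B)) : Type v := ∀ σ, Var Γ σ → Var Δ σ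

def Sub (V : Vocabulary.{v}) (Γ Δ : List (Ty V.B)) : Type v := ∀ σ, Var Γ σ → Tm V Δ σ

def Ren.lift {Γ Δ : List (Ty V.B)} (r : Ren V Γ Δ) (τ : Ty V.B) : Ren V (τ :: Γ) (τ :: Δ)
  | _, .zero => .zero
  | _, .succ x => .succ (r _ x)

def Tm.rename : {Γ Δ : List (Ty V.B)} → {σ : Ty V.B} → Ren V Γ Δ → Tm V Γ σ → Tm V Δ σ
  | _, _, _, r, .var x => .var (r _ x)
  | _, _, _, _, .con c => .con c
  | _, _, _, r, .fn f M => .fn f fun i => (M i).rename r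
  | _, _, _, r, .ite L M N => .ite (L.rename r) (M.rename r) (N.rename r)
  | _, _, _, r, .or M N => .or (M.rename r) (N.rename r)
  | _, _, _, r, .reward N M => .reward (N.rename r) (M.rename r)
  | _, _, _, r, .prob p M N => .prob p (M.rename r) (N.rename r)
  | _, _, _, _, .star => .star
  | _, _, _, r, .pair M N => .pair (M.rename r) (N.rename r)
  | _, _, _, r, .fst M => .fst (M.rename r)
  | _, _, _, r, .snd M => .snd (M.rename r)
  | _, _, _, r, .lam M => .lam (M.rename (r.lift _))
  | _, _, _, r, .app M N => .app (M.rename r) (N.rename r)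

def Sub.lift {Γ Δ : List (Ty V.B)} (s : Sub V Γ Δ) (τ : Ty V.B) : Sub V (τ :: Γ) (τ :: Δ)
  | _, .zero => .var .zero
  | _, .succ x => (s _ x).rename fun _ => Var.succ

def Tm.subst : {Γ Δ : List (Ty V.B)} → {σ : Ty V.B} → Sub V Γ Δ → Tm V Γ σ → Tm V Δ σ
  | _, _, _, s, .var x => s _ x
  | _, _, _, _, .con c => .con c
  | _, _, _, s, .fn f M => .fn f fun i => (M i).subst s
  | _, _, _, s, .ite L M N => .ite (L.subst s) (M.subst s) (N.subst s)
  | _, _, _, s, .or M N => .or (M.subst s) (N.subst s)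
  | _, _, _, s, .reward N M => .reward (N.subst s) (M.subst s)
  | _, _, _, s, .prob p M N => .prob p (M.subst s) (N.subst s)
  | _, _, _, _, .star => .star
  | _, _, _, s, .pair M N => .pair (M.subst s) (N.subst s)
  | _, _, _, s, .fst M => .fst (M.subst s)
  | _, _, _, s, .snd M => .snd (M.subst s)
  | _, _, _, s, .lam M => .lam (M.subst (s.lift _))
  | _, _, _, s, .app M N => .app (M.subst s) (N.subst s)

/-- The substitution of a closed term for the only free variable. -/
def Sub.single {σ : Ty V.B} (N : Program V σ) : Sub V [σ] []
  | _, .zero => N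

/-- `M[N/x]`. -/
def Tm.inst {σ τ : Ty V.B} (M : Tm V [σ] τ) (N : Program V σ) : Program V τ :=
  M.subst (Sub.single N)

end Subst

/-! ### Ordinary operational semantics -/

/-- Closed values. -/
inductive Val (V : Vocabulary.{v}) : Ty V.B → Type v
  | con {b : BaseTy V.B} (c : V.Con b) : Val V (.base b)
  | star : Val V .unit
  | pair {σ τ : Ty V.B} (v : Val V σ) (w : Val V τ) : Val V (.prod σ τ)
  | lam {σ τ : Ty V.B} (M : Tm V [σ] τ) : Val V (.arrow σ τ)

def Val.toTm {V : Vocabulary.{v}} : {σ : Ty V.B} → Val V σ → Program V σ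
  | _, .con c => .con c
  | _, .star => .star
  | _, .pair v w => .pair v.toTm w.toTm
  | _, .lam M => .lam M

/-- Closed evaluation contexts with a hole of type `τ`. In `fn f k M h E`, the `k`-th argument
of `f` is `E`, the earlier ones are constants, and `M k` is ignored. -/
inductive EvalCtx (V : Vocabulary.{v}) (τ : Ty V.B) : Ty V.B → Type v
  | hole : EvalCtx V τ τ
  | fn (f : FnSym V) (k : Fin f.arity) (M : ∀ i, Program V (.base (f.dom i)))
      (h : ∀ i, i < k → ∃ c, M i = .con c) (E : EvalCtx V τ (.base (f.dom k))) :
      EvalCtx V τ (.base f.cod)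
  | ite {σ : Ty V.B} (E : EvalCtx V τ (.base .bool)) (M N : Program V σ) : EvalCtx V τ σ
  | reward {σ : Ty V.B} (E : EvalCtx V τ (.base .rew)) (M : Program V σ) : EvalCtx V τ σ
  | pairL {σ σ' : Ty V.B} (E : EvalCtx V τ σ) (N : Program V σ') : EvalCtx V τ (.prod σ σ')
  | pairR {σ σ' : Ty V.B} (v : Val V σ) (E : EvalCtx V τ σ') : EvalCtx V τ (.prod σ σ')
  | fst {σ σ' : Ty V.B} (E : EvalCtx V τ (.prod σ σ')) : EvalCtx V τ σ
  | snd {σ σ' : Ty V.B} (E : EvalCtx V τ (.prod σ σ')) : EvalCtx V τ σ'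
  | appL {σ σ' : Ty V.B} (E : EvalCtx V τ (.arrow σ σ')) (N : Program V σ) : EvalCtx V τ σ'
  | appR {σ σ' : Ty V.B} (M : Tm V [σ] σ') (E : EvalCtx V τ σ) : EvalCtx V τ σ'

/-- `E[P]`. -/
def EvalCtx.plug {V : Vocabulary.{v}} {τ : Ty V.B} (P : Program V τ) :
    {σ : Ty V.B} → EvalCtx V τ σ → Program V σ
  | _, .hole => P
  | _, .fn f k M _ E => .fn f (Function.update M k (E.plug P))
  | _, .ite E M N => .ite (E.plug P) M N
  | _, .reward E M => .reward (E.plug P) M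
  | _, .pairL E N => .pair (E.plug P) N
  | _, .pairR v E => .pair v.toTm (E.plug P)
  | _, .fst E => .fst (E.plug P)
  | _, .snd E => .snd (E.plug P)
  | _, .appL E N => .app (E.plug P) N
  | _, .appR M E => .app (.lam M) (E.plug P)

/-- Ordinary transitions of redexes. -/
inductive RedexStep {V : Vocabulary.{v}} (ev : FnEval V) :
    {σ : Ty V.B} → Program V σ → Program V σ → Prop
  | fn (f : FnSym V) (c : ∀ i, V.Con (f.dom i)) :
      RedexStep ev (.fn f fun i => .con (c i)) (.con (ev.val f c))
  | ite_tt {σ : Ty V.B} (M N : Program V σ) : RedexStep ev (.ite (.con V.tt) M N) M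
  | ite_ff {σ : Ty V.B} (M N : Program V σ) : RedexStep ev (.ite (.con V.ff) M N) N
  | fst {σ τ : Ty V.B} (v : Val V σ) (w : Val V τ) :
      RedexStep ev (.fst (.pair v.toTm w.toTm)) v.toTm
  | snd {σ τ : Ty V.B} (v : Val V σ) (w : Val V τ) :
      RedexStep ev (.snd (.pair v.toTm w.toTm)) w.toTm
  | beta {σ τ : Ty V.B} (M : Tm V [σ] τ) (v : Val V σ) :
      RedexStep ev (.app (.lam M) v.toTm) (M.inst v.toTm)

/-- Labels of algebraic operation transitions: the operation with its parameters, and the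
argument that is followed. -/
inductive OpLabel (V : Vocabulary.{v}) : Type v
  | or (i : Fin 2)
  | reward (c : V.Con .rew)
  | prob (p : Prob) (i : Fin 2)

/-- Algebraic operation transitions of redexes. -/
inductive RedexOpStep {V : Vocabulary.{v}} :
    {σ : Ty V.B} → Program V σ → OpLabel V → Program V σ → Prop
  | or_zero {σ : Ty V.B} (M N : Program V σ) : RedexOpStep (.or M N) (.or 0) M
  | or_one {σ : Ty V.B} (M N : Program V σ) : RedexOpStep (.or M N) (.or 1) N
  | reward {σ : Ty V.B} (c : V.Con .rew) (M : Program V σ) :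
      RedexOpStep (.reward (.con c) M) (.reward c) M
  | prob_zero {σ : Ty V.B} (p : Prob) (M N : Program V σ) :
      RedexOpStep (.prob p M N) (.prob p 0) M
  | prob_one {σ : Ty V.B} (p : Prob) (M N : Program V σ) :
      RedexOpStep (.prob p M N) (.prob p 1) N

inductive Step {V : Vocabulary.{v}} (ev : FnEval V) {σ : Ty V.B} :
    Program V σ → Program V σ → Prop
  | ctx {τ : Ty V.B} (E : EvalCtx V τ σ) {P P' : Program V τ} (h : RedexStep ev P P') :
      Step ev (E.plug P) (E.plug P')

inductive OpStep {V : Vocabulary.{v}} {σ : Ty V.B} :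
    Program V σ → OpLabel V → Program V σ → Prop
  | ctx {τ : Ty V.B} (E : EvalCtx V τ σ) {P P' : Program V τ} {l : OpLabel V}
      (h : RedexOpStep P l P') : OpStep (E.plug P) l (E.plug P')

/-- Big-step ordinary transitions. -/
def BigStep {V : Vocabulary.{v}} (ev : FnEval V) {σ : Ty V.B} (M : Program V σ) (v : Val V σ) :
    Prop :=
  Relation.ReflTransGen (Step ev) M v.toTm

/-- Big-step algebraic operation transitions. -/
def BigOpStep {V : Vocabulary.{v}} (ev : FnEval V) {σ : Ty V.B} (M : Program V σ)
    (l : OpLabel V) (M'' : Program V σ) : Prop :=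
  ∃ M', Relation.ReflTransGen (Step ev) M M' ∧ OpStep M' l M''

/-- Effect values. -/
inductive EffVal (V : Vocabulary.{v}) (σ : Ty V.B) : Type v
  | val (v : Val V σ)
  | or (E₁ E₂ : EffVal V σ)
  | reward (c : V.Con .rew) (E : EffVal V σ)
  | prob (p : Prob) (E₁ E₂ : EffVal V σ)

/-- `Evaluates ev M E` says that `Op(M) = E`. -/
inductive Evaluates {V : Vocabulary.{v}} (ev : FnEval V) {σ : Ty V.B} :
    Program V σ → EffVal V σ → Prop
  | val {M : Program V σ} {v : Val V σ} (h : BigStep ev M v) : Evaluates ev M (.val v)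
  | or {M M₁ M₂ : Program V σ} {E₁ E₂ : EffVal V σ}
      (h₁ : BigOpStep ev M (.or 0) M₁) (h₂ : BigOpStep ev M (.or 1) M₂)
      (e₁ : Evaluates ev M₁ E₁) (e₂ : Evaluates ev M₂ E₂) : Evaluates ev M (.or E₁ E₂)
  | reward {M M' : Program V σ} {c : V.Con .rew} {E : EffVal V σ}
      (h : BigOpStep ev M (.reward c) M') (e : Evaluates ev M' E) : Evaluates ev M (.reward c E)
  | prob {M M₁ M₂ : Program V σ} {p : Prob} {E₁ E₂ : EffVal V σ}
      (h₁ : BigOpStep ev M (.prob p 0) M₁) (h₂ : BigOpStep ev M (.prob p 1) M₂)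
      (e₁ : Evaluates ev M₁ E₁) (e₂ : Evaluates ev M₂ E₂) : Evaluates ev M (.prob p E₁ E₂)

/-! ### Interpretations of the vocabulary -/

/-- The denotations of base types: `Bool` denotes the booleans and `Rew` denotes `R`. -/
@[reducible]
def baseSem (R : Type u) {B : Type v} (sem : B → Type u) : BaseTy B → Type u
  | .bool => ULift.{u} Bool
  | .rew => R
  | .other b => sem b

/-- A semantics of base types, constants and function symbols: different constants have
different denotations, function symbols are consistent with their evaluation, and some constant
of type `Rew` does not denote zero. -/
structure Interpretation (V : Vocabulary.{v}) (ev : FnEval V) (R : Type u) [RewardSpace R] where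
  sem : V.B → Type u
  sem_nonempty : ∀ b, Nonempty (sem b)
  con : ∀ {b : BaseTy V.B}, V.Con b → baseSem R sem b
  fn : ∀ f : FnSym V, (∀ i, baseSem R sem (f.dom i)) → baseSem R sem f.cod
  con_injective : ∀ b : BaseTy V.B, Function.Injective (con (b := b))
  con_tt : con V.tt = ULift.up true
  con_ff : con V.ff = ULift.up false
  con_zero : con V.zero = (0 : R)
  exists_con_ne_zero : ∃ c : V.Con .rew, con c ≠ (0 : R)
  fn_add : ∀ x : Fin 2 → R, fn .add x = x 0 + x 1
  fn_le : ∀ x : Fin 2 → R, fn .le x = ULift.up (decide (x 0 ≤ x 1))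
  fn_oplus : ∀ (p : Prob) (x : Fin 2 → R), fn (.oplus p) x = RewardSpace.pc p (x 0) (x 1)
  fn_con : ∀ (f : FnSym V) (c : ∀ i, V.Con (f.dom i)),
    fn f (fun i => con (c i)) = con (ev.val f c)

/-! ### Selection operational semantics -/

/-- The least of the elements of a finite total order at which `γ` is maximal. -/
noncomputable def argmax {S : Type*} [LinearOrder S] [Fintype S] [Nonempty S] {R : Type u}
    [LinearOrder R] (γ : S → R) : S :=
  (Finset.univ.filter fun s => ∀ s', γ s' ≤ γ s).min' <| by
    obtain ⟨s, hs⟩ := Finite.exists_max γ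
    exact ⟨s, by simpa using hs⟩

/-- The strategies of an effect value, with the sum and the product ordered
lexicographically. -/
def Str {V : Vocabulary.{v}} {σ : Ty V.B} : EffVal V σ → Type
  | .val _ => Unit
  | .or E₁ E₂ => Lex (Str E₁ ⊕ Str E₂)
  | .reward _ E => Str E
  | .prob _ E₁ E₂ => Lex (Str E₁ × Str E₂)

noncomputable instance Str.linearOrder {V : Vocabulary.{v}} {σ : Ty V.B} :
    (E : EffVal V σ) → LinearOrder (Str E)
  | .val _ => PUnit.instLinearOrder
  | .or E₁ E₂ => @Sum.Lex.linearOrder _ _ (Str.linearOrder E₁) (Str.linearOrder E₂)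
  | .reward _ E => Str.linearOrder E
  | .prob _ E₁ E₂ => @Prod.Lex.instLinearOrder _ _ (Str.linearOrder E₁) (Str.linearOrder E₂)

noncomputable instance Str.fintype {V : Vocabulary.{v}} {σ : Ty V.B} :
    (E : EffVal V σ) → Fintype (Str E)
  | .val _ => PUnit.fintype
  | .or E₁ E₂ => @instFintypeSum _ _ (Str.fintype E₁) (Str.fintype E₂)
  | .reward _ E => Str.fintype E
  | .prob _ E₁ E₂ => @instFintypeProd _ _ (Str.fintype E₁) (Str.fintype E₂)

instance Str.nonempty {V : Vocabulary.{v}} {σ : Ty V.B} :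
    (E : EffVal V σ) → Nonempty (Str E)
  | .val _ => ⟨()⟩
  | .or E₁ _ => (Str.nonempty E₁).map fun s => toLex (Sum.inl s)
  | .reward _ E => Str.nonempty E
  | .prob _ E₁ E₂ => (Str.nonempty E₁).elim fun s₁ =>
      (Str.nonempty E₂).map fun s₂ => toLex (s₁, s₂)

section Selection

variable {V : Vocabulary.{v}} {ev : FnEval V} {R : Type u} [RewardSpace R]

/-- The outcome of a strategy. -/
noncomputable def Interpretation.out (I : Interpretation V ev R) {σ : Ty V.B} :
    (E : EffVal V σ) → Str E → DW R (Val V σ)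
  | .val v, _ => StdSimplex.single (0, v)
  | .or E₁ E₂, s => Sum.elim (I.out E₁) (I.out E₂) (ofLex s)
  | .reward c E, s => DW.act (I.con c : R) (I.out E s)
  | .prob p E₁ E₂, s => mix p (I.out E₁ (ofLex s).1) (I.out E₂ (ofLex s).2)

/-- The selection operational semantics `Op_s(M)` of a program `M` with `Op(M) = E`: the
outcome of the least strategy that maximizes the expected reward. -/
noncomputable def Interpretation.opS (I : Interpretation V ev R) {σ : Ty V.B}
    (E : EffVal V σ) : DW R (Val V σ) :=
  I.out E (argmax fun s : Str E => (I.out E s).expect)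

end Selection

/-! ### Denotational semantics -/

section Denotation

variable {V : Vocabulary.{v}} {ev : FnEval V} {R : Type u} [RewardSpace R]

/-- Denotations of types. -/
def Interpretation.ty (I : Interpretation V ev R) (T : Type u → Type u) : Ty V.B → Type u
  | .base b => baseSem R I.sem b
  | .unit => PUnit
  | .prod σ τ => I.ty T σ × I.ty T τ
  | .arrow σ τ => I.ty T σ → Sel R T (I.ty T τ)

/-- Denotations of contexts. -/
def Interpretation.env (I : Interpretation V ev R) (T : Type u → Type u) :
    List (Ty V.B) → Type u
  | [] => PUnit
  | σ :: Γ => I.ty T σ × I.env T Γ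

def Interpretation.lookup (I : Interpretation V ev R) (T : Type u → Type u) :
    {Γ : List (Ty V.B)} → {σ : Ty V.B} → Var Γ σ → I.env T Γ → I.ty T σ
  | _, _, .zero, ρ => ρ.1
  | _, _, .succ x, ρ => I.lookup T x ρ.2

variable {T : Type u → Type u} [Monad T]

/-- Denotations of terms. -/
def Interpretation.den (I : Interpretation V ev R) (A : AuxData R T) :
    {Γ : List (Ty V.B)} → {σ : Ty V.B} → Tm V Γ σ → I.env T Γ → Sel R T (I.ty T σ)
  | _, _, .var x, ρ => selPure (I.lookup T x ρ)
  | _, _, .con c, _ => selPure (I.con c)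
  | _, _, .fn f M, ρ =>
      A.selBind (A.selSeq (X := fun i => baseSem R I.sem (f.dom i)) fun i => I.den A (M i) ρ)
        fun x => selPure (I.fn f x)
  | _, _, .ite L M N, ρ =>
      A.selBind (I.den A L ρ) fun b : ULift Bool =>
        if b.down then I.den A M ρ else I.den A N ρ
  | _, _, .or M N, ρ => A.selOr (I.den A M ρ) (I.den A N ρ)
  | _, _, .reward N M, ρ =>
      A.selBind (I.den A N ρ) fun r : R => A.selReward r (I.den A M ρ)
  | _, _, .prob p M N, ρ => A.selProb p (I.den A M ρ) (I.den A N ρ)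
  | _, _, .star, _ => selPure PUnit.unit
  | _, _, .pair M N, ρ =>
      A.selBind (I.den A M ρ) fun x => A.selBind (I.den A N ρ) fun y => selPure (x, y)
  | _, _, .fst M, ρ => A.selBind (I.den A M ρ) fun z => selPure z.1
  | _, _, .snd M, ρ => A.selBind (I.den A M ρ) fun z => selPure z.2
  | _, _, .lam M, ρ => selPure fun x => I.den A M (x, ρ)
  | _, _, .app M N, ρ =>
      A.selBind (I.den A M ρ) fun f => A.selBind (I.den A N ρ) fun x => f x

/-- Denotations of programs. -/
def Interpretation.denP (I : Interpretation V ev R) (A : AuxData R T) {σ : Ty V.B}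
    (M : Program V σ) : Sel R T (I.ty T σ) :=
  I.den A M PUnit.unit

/-- The effect-free semantics of values. -/
def Interpretation.denVal (I : Interpretation V ev R) (A : AuxData R T) :
    {σ : Ty V.B} → Val V σ → I.ty T σ
  | _, .con c => I.con c
  | _, .star => PUnit.unit
  | _, .pair v w => (I.denVal A v, I.denVal A w)
  | _, .lam M => fun x => I.den A M (x, PUnit.unit)

/-- The map sending `∑ pᵢ (rᵢ, vᵢ)` in `DW(Val_σ)` to `∑ pᵢ (rᵢ · η(⟦vᵢ⟧))` in `T(⟦σ⟧)`. -/
noncomputable def Interpretation.denDW (I : Interpretation V ev R) (A : AuxData R T)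
    {σ : Ty V.B} (μ : DW R (Val V σ)) : T (I.ty T σ) :=
  DW.extend A.reward A.prob (fun v => pure (I.denVal A v)) μ

end Denotation

/-! ### Three auxiliary monads -/

section Monads

variable (R : Type u) [RewardSpace R]

/-- `T₁(X) = DW(X)`. -/
def T1 (X : Type u) : Type u := DW R X

noncomputable instance T1.monad : Monad (T1 R) where
  pure x := StdSimplex.single ((0 : R), x)
  bind {X Y} μ f := DW.extend (X := X) (A := DW R Y) DW.act mix f μ

noncomputable def T1.aux : AuxData R (T1 R) where
  genReward r := StdSimplex.single (r, PUnit.unit)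
  genProb p := mix p (StdSimplex.single ((0 : R), ULift.up 0))
    (StdSimplex.single ((0 : R), ULift.up 1))
  alg := DW.extend (fun r s : R => r + s) RewardSpace.pc id

/-- `T₂(X)`: finite distributions `μ` on `X` with a reward function on the support of `μ`. The
reward function is extended by zero outside the support. -/
@[ext]
structure T2 (X : Type u) : Type u where
  dist : StdSimplex ℝ X
  rew : X → R
  rew_eq_zero : ∀ x, dist.weights x = 0 → rew x = 0

variable {R}

open Classical in
/-- The pair of `μ` and the restriction of `ρ` to the support of `μ`. -/
noncomputable def T2.ofFun {X : Type u} (μ : StdSimplex ℝ X) (ρ : X → R) : T2 R X where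
  dist := μ
  rew x := if μ.weights x = 0 then 0 else ρ x
  rew_eq_zero _ h := if_pos h

noncomputable def T2.act {X : Type u} (r : R) (a : T2 R X) : T2 R X :=
  T2.ofFun a.dist fun x => r + a.rew x

/-- The mixture of `a` and `b`: at `x` in the support of the mixture `ν` of the distributions
`μ` and `μ'` of `a` and `b`, its reward function is the convex combination of those of `a` and `b`
with weight `p μ(x) / ν(x)` (which is `1` or `0` when `x` is in only one of the supports). -/
noncomputable def T2.comb {X : Type u} (p : Prob) (a b : T2 R X) : T2 R X :=
  T2.ofFun (mix p a.dist b.dist) fun x =>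
    RewardSpace.pc (Set.projIcc (0 : ℝ) 1 zero_le_one
      (p * a.dist.weights x / (mix p a.dist b.dist).weights x)) (a.rew x) (b.rew x)

/-- The extension of `f : X → A` to `T₂(X)`, sending `(μ, ρ)` to `∑ x, μ(x) (ρ(x) · f x)`. -/
noncomputable def T2.extend {X : Type u} {A : Type*} (act : R → A → A)
    (comb : Prob → A → A → A) (f : X → A) (a : T2 R X) : A :=
  convexSum comb a.dist (fun x => act (a.rew x) (f x))

variable (R)

noncomputable def T2.unit {X : Type u} (x : X) : T2 R X :=
  T2.ofFun (StdSimplex.single x) fun _ => 0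

noncomputable instance T2.monad : Monad (T2 R) where
  pure x := T2.unit R x
  bind a f := T2.extend T2.act T2.comb f a

noncomputable def T2.aux : AuxData R (T2 R) where
  genReward r := T2.act r (T2.unit R PUnit.unit)
  genProb p := T2.comb p (T2.unit R (ULift.up 0)) (T2.unit R (ULift.up 1))
  alg := T2.extend (fun r s : R => r + s) RewardSpace.pc id

/-- `T₃(X)`: pairs of a finite distribution on `X` and a reward. -/
@[ext]
structure T3 (X : Type u) : Type u where
  dist : StdSimplex ℝ X
  rew : R

variable {R}

noncomputable def T3.act {X : Type u} (r : R) (a : T3 R X) : T3 R X :=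
  ⟨a.dist, r + a.rew⟩

noncomputable def T3.comb {X : Type u} (p : Prob) (a b : T3 R X) : T3 R X :=
  ⟨mix p a.dist b.dist, RewardSpace.pc p a.rew b.rew⟩

/-- The extension of `f : X → A` to `T₃(X)`, sending `(∑ pᵢ xᵢ, r)` to `r · ∑ pᵢ f(xᵢ)`. -/
noncomputable def T3.extend {X : Type u} {A : Type*} (act : R → A → A)
    (comb : Prob → A → A → A) (f : X → A) (a : T3 R X) : A :=
  act a.rew (convexSum comb a.dist f)

variable (R)

noncomputable instance T3.monad : Monad (T3 R) where
  pure x := ⟨StdSimplex.single x, 0⟩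
  bind a f := T3.extend T3.act T3.comb f a

noncomputable def T3.aux : AuxData R (T3 R) where
  genReward r := ⟨StdSimplex.single PUnit.unit, r⟩
  genProb p := ⟨mix p (StdSimplex.single (ULift.up 0)) (StdSimplex.single (ULift.up 1)), 0⟩
  alg := T3.extend (fun r s : R => r + s) RewardSpace.pc id

/-- The equation `r·x +_p s·y = (r +_p s)·x +_p (r +_p s)·y` in `R`, needed for `T₃`. -/
def GathersRewards : Prop :=
  ∀ (p : Prob) (r s x y : R), RewardSpace.pc p (r + x) (s + y) =
    RewardSpace.pc p (RewardSpace.pc p r s + x) (RewardSpace.pc p r s + y)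

end Monads

end SelLang

open SelLang

set_option linter.unusedSectionVars false

/-! Evaluation. The transition relations are the graph of one total function `next`, defined by
recursion on closed terms. Every transition agrees with it (`next_of_step`, `hasOp_of_opStep`) and
every answer that it gives is a transition (`next_sound`). Hence `Evaluates` coincides with `Runs`,
which iterates a function, and effect values are unique. They exist by a Tait-style reducibility
argument: `Comp` says that every branch of the computation ends in a reducible value, and
`comp_subst` is the fundamental lemma.

Adequacy. In the selection monad, `or`, reward and probabilistic choice commute with Kleisli
extension. For `or` this uses that `α` is a `T`-algebra, so the reward of a composite can be
computed in two stages. Therefore a program denotes the same as what it does next (`denP_next`), and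
so the same as its effect value read as a tree of operations (`denP_eq_denEff`). It remains to
evaluate that tree at the zero reward function. At zero reward, the reward of a denoted outcome is
its expected reward (`rewardOf_denDW`), so both sides make their choices by the same comparison. The
global optimum over strategies is moreover compositional: adding a reward preserves and reflects the
order, mixing with a weight strictly between 0 and 1 does so in each argument, and the lexicographic
order breaks ties componentwise and in favour of the left branch. Thus `opS` satisfies the recursion
that defines the denotation, and `denEff_zero` is an induction on effect values.

The monads. Each is generated by its units under action and mixture, and its extensions are module
homomorphisms. So the monad laws and the axioms on `T` need to be checked on generators only;
`AuxData.IsFree` collects what this takes. Computations with convex combinations go through the cone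
of a barycentric algebra: points embed as multiples of weight one in a commutative monoid, where
iterated combinations become finite sums. Independence of enumeration, compatibility with mixtures
and the laws of `T2` then reduce to identities between weights. -/

namespace SelLang

/-! ### Operational semantics as a deterministic function -/

section Operational

variable {V : Vocabulary.{v}}

/-! ### The one-step function -/

/-- The constant that a closed value of base type is. -/
def Val.toCon {b : BaseTy V.B} : Val V (.base b) → V.Con b
  | .con c => c

def Val.fst {σ τ : Ty V.B} : Val V (.prod σ τ) → Val V σ
  | .pair v _ => v

def Val.snd {σ τ : Ty V.B} : Val V (.prod σ τ) → Val V τ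
  | .pair _ w => w

def Val.body {σ τ : Ty V.B} : Val V (.arrow σ τ) → Tm V [σ] τ
  | .lam M => M

/-- What a program does next. -/
inductive Res (V : Vocabulary.{v}) (σ : Ty V.B) : Type v
  | val (v : Val V σ)
  | step (M : Program V σ)
  | or (M N : Program V σ)
  | reward (c : V.Con .rew) (M : Program V σ)
  | prob (p : Prob) (M N : Program V σ)

/-- Apply `k` to all programs; continue with `kv` on values. -/
def Res.bind {σ τ : Ty V.B} (k : Program V σ → Program V τ) (kv : Val V σ → Res V τ) :
    Res V σ → Res V τ
  | .val v => kv v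
  | .step M => .step (k M)
  | .or M N => .or (k M) (k N)
  | .reward c M => .reward c (k M)
  | .prob p M N => .prob p (k M) (k N)

def Res.IsVal {σ : Ty V.B} (r : Res V σ) : Prop := ∃ v, r = .val v

/-- Structural recursion and induction on terms need a variable context. The equation `Γ = []` is
therefore carried as a hypothesis, and terms are transported along it. -/
def closeTm {Γ : List (Ty V.B)} {σ : Ty V.B} (h : Γ = []) (M : Tm V Γ σ) : Tm V [] σ := h ▸ M

def closeLam {Γ : List (Ty V.B)} {σ τ : Ty V.B} (h : Γ = []) (M : Tm V (σ :: Γ) τ) :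
    Tm V [σ] τ := h ▸ M

def pairNext {σ τ : Ty V.B} (r : Res V σ) (r' : Res V τ) (N : Program V τ) :
    Res V (.prod σ τ) :=
  r.bind (fun M => .pair M N) fun v => r'.bind (fun N => .pair v.toTm N) fun w => .val (.pair v w)

def fstNext {σ τ : Ty V.B} (r : Res V (.prod σ τ)) : Res V σ :=
  r.bind .fst fun v => .step v.fst.toTm

def sndNext {σ τ : Ty V.B} (r : Res V (.prod σ τ)) : Res V τ :=
  r.bind .snd fun v => .step v.snd.toTm

def appNext {σ τ : Ty V.B} (r : Res V (.arrow σ τ)) (r' : Res V σ) (N : Program V σ) : Res V τ :=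
  r.bind (fun M => .app M N) fun v =>
    r'.bind (fun N => .app (.lam v.body) N) fun w => .step (v.body.inst w.toTm)

def rewardNext {σ : Ty V.B} (r : Res V (.base .rew)) (M : Program V σ) : Res V σ :=
  r.bind (fun N => .reward N M) fun v => .reward v.toCon M

open Classical in
noncomputable def iteNext {σ : Ty V.B} (r : Res V (.base .bool)) (M N : Program V σ) : Res V σ :=
  r.bind (fun L => .ite L M N) fun v => .step (if v.toCon = V.tt then M else N)

open Classical in
/-- The first argument that is not a value takes its step. -/
noncomputable def fnNext (ev : FnEval V) (f : FnSym V) (M : ∀ i, Program V (.base (f.dom i)))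
    (r : ∀ i, Res V (.base (f.dom i))) : Res V (.base f.cod) :=
  if h : ∀ i, (r i).IsVal then .step (.con (ev.val f fun i => (h i).choose.toCon))
  else
    have h' : (Finset.univ.filter fun i => ¬ (r i).IsVal).Nonempty := by
      push Not at h; simpa [Finset.Nonempty] using h
    -- The value continuation is a dummy: the selected result is not a value.
    (r ((Finset.univ.filter fun i => ¬ (r i).IsVal).min' h')).bind
      (fun P => .fn f (Function.update M _ P)) fun _ => .step (.fn f M)

/-- The context stays general so that the recursion is structural; `Γ = []` rules out the variable
case. -/
noncomputable def nextAux (ev : FnEval V) :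
    {Γ : List (Ty V.B)} → {σ : Ty V.B} → Tm V Γ σ → Γ = [] → Res V σ
  | _, _, .var x, h => by subst h; cases x
  | _, _, .con c, _ => .val (.con c)
  | _, _, .fn f M, h => fnNext ev f (fun i => closeTm h (M i)) (fun i => nextAux ev (M i) h)
  | _, _, .ite L M N, h => iteNext (nextAux ev L h) (closeTm h M) (closeTm h N)
  | _, _, .or M N, h => .or (closeTm h M) (closeTm h N)
  | _, _, .reward N M, h => rewardNext (nextAux ev N h) (closeTm h M)
  | _, _, .prob p M N, h => .prob p (closeTm h M) (closeTm h N)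
  | _, _, .star, _ => .val .star
  | _, _, .pair M N, h => pairNext (nextAux ev M h) (nextAux ev N h) (closeTm h N)
  | _, _, .fst M, h => fstNext (nextAux ev M h)
  | _, _, .snd M, h => sndNext (nextAux ev M h)
  | _, _, .lam M, h => .val (.lam (closeLam h M))
  | _, _, .app M N, h => appNext (nextAux ev M h) (nextAux ev N h) (closeTm h N)

noncomputable def next (ev : FnEval V) {σ : Ty V.B} (M : Program V σ) : Res V σ :=
  nextAux ev M rfl

/-- Only subterms in evaluation position get an induction hypothesis. Branches, arguments of `or`
and of probabilistic choice, and bodies of abstractions are not evaluated in place; the bodies are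
not even closed. -/
theorem Program.induction {motive : ∀ σ, Program V σ → Prop}
    (con : ∀ {b : BaseTy V.B} (c : V.Con b), motive _ (.con c))
    (fn : ∀ (f : FnSym V) (M : ∀ i, Program V (.base (f.dom i))), (∀ i, motive _ (M i)) →
      motive _ (.fn f M))
    (ite : ∀ {σ} (L : Program V (.base .bool)) (M N : Program V σ), motive _ L →
      motive _ (.ite L M N))
    (or : ∀ {σ} (M N : Program V σ), motive _ (.or M N))
    (reward : ∀ {σ} (N) (M : Program V σ), motive _ N → motive _ (.reward N M))
    (prob : ∀ {σ} (p) (M N : Program V σ), motive _ (.prob p M N))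
    (star : motive _ .star)
    (pair : ∀ {σ τ} (M : Program V σ) (N : Program V τ), motive _ M → motive _ N →
      motive _ (.pair M N))
    (fst : ∀ {σ τ} (M : Program V (.prod σ τ)), motive _ M → motive _ (.fst M))
    (snd : ∀ {σ τ} (M : Program V (.prod σ τ)), motive _ M → motive _ (.snd M))
    (lam : ∀ {σ τ} (M : Tm V [σ] τ), motive _ (.lam M))
    (app : ∀ {σ τ} (M : Program V (.arrow σ τ)) (N : Program V σ), motive _ M → motive _ N →
      motive _ (.app M N))
    {σ : Ty V.B} (M : Program V σ) : motive σ M := by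
  suffices H : ∀ (Γ : List (Ty V.B)) (σ : Ty V.B) (M : Tm V Γ σ) (h : Γ = []),
      motive σ (closeTm h M) from H _ _ M rfl
  intro Γ σ M
  induction M with
  | var x => rintro rfl; cases x
  | con c => rintro rfl; exact con c
  | fn f M ih => rintro rfl; exact fn f M fun i => ih i rfl
  | ite L M N ih => rintro rfl; exact ite L M N (ih rfl)
  | or M N => rintro rfl; exact or M N
  | reward N M ih => rintro rfl; exact reward N M (ih rfl)
  | prob p M N => rintro rfl; exact prob p M N
  | star => rintro rfl; exact star
  | pair M N ih ih' => rintro rfl; exact pair M N (ih rfl) (ih' rfl)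
  | fst M ih => rintro rfl; exact fst M (ih rfl)
  | snd M ih => rintro rfl; exact snd M (ih rfl)
  | lam M => rintro rfl; exact lam M
  | app M N ih ih' => rintro rfl; exact app M N (ih rfl) (ih' rfl)

variable (ev : FnEval V)

theorem next_toTm {σ : Ty V.B} (v : Val V σ) : next ev v.toTm = .val v := by
  induction v with
  | con c => rfl
  | star => rfl
  | lam M => rfl
  | pair v w ihv ihw =>
    change pairNext (next ev v.toTm) (next ev w.toTm) w.toTm = _
    rw [ihv, ihw]; rfl

theorem Val.toTm_con {b : BaseTy V.B} (v : Val V (.base b)) : v.toTm = .con v.toCon := by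
  cases v; rfl

theorem fnNext_con (f : FnSym V) (c : ∀ i, V.Con (f.dom i)) :
    next ev (.fn f fun i => .con (c i)) = .step (.con (ev.val f c)) := by
  change fnNext ev f (fun i => .con (c i)) (fun i => .val (.con (c i))) = _
  have h : ∀ i, Res.IsVal (.val (.con (c i)) : Res V (.base (f.dom i))) := fun i => ⟨_, rfl⟩
  rw [fnNext, dif_pos h]
  congr 3
  funext i
  have := (h i).choose_spec
  rw [Res.val.injEq] at this
  rw [← this]; rfl

theorem fnNext_of_not_isVal (f : FnSym V) (M : ∀ i, Program V (.base (f.dom i)))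
    (r : ∀ i, Res V (.base (f.dom i))) (k : Fin f.arity) (hk : ¬ (r k).IsVal)
    (h : ∀ i < k, (r i).IsVal) (kv : Val V (.base (f.dom k)) → Res V (.base f.cod)) :
    fnNext ev f M r = (r k).bind (fun P => .fn f (Function.update M k P)) kv := by
  classical
  have h₀ : ¬ ∀ i, (r i).IsVal := fun h => hk (h k)
  rw [fnNext, dif_neg h₀]
  have hmin : ∀ h', (Finset.univ.filter fun i => ¬ (r i).IsVal).min' h' = k := by
    intro h'
    refine le_antisymm (Finset.min'_le _ _ (by simpa using hk)) ?_
    refine Finset.le_min' _ _ _ fun i hi => ?_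
    by_contra hlt
    exact (Finset.mem_filter.1 hi).2 (h i (not_le.1 hlt))
  have key : ∀ j, j = k → ∀ kv', (r j).bind (fun P => Tm.fn f (Function.update M j P)) kv' =
      (r k).bind (fun P => .fn f (Function.update M k P)) kv := by
    rintro j rfl kv'
    cases hr : r j with
    | val v => exact absurd ⟨v, hr⟩ hk
    | _ => rfl
  convert key _ (hmin _) _

/-- A program whose subprogram in an evaluation context is not a value does what the subprogram
does. -/
theorem next_plug {σ τ : Ty V.B} (E : EvalCtx V τ σ) (P : Program V τ)
    (h : ¬ (next ev P).IsVal) :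
    ∀ kv, next ev (E.plug P) = (next ev P).bind (fun P' => E.plug P') kv := by
  -- Two nested frames compose. As the innermost result is not a value, all value continuations are
  -- irrelevant and may be chosen arbitrarily.
  have key : ∀ {ρ ρ' : Ty V.B} (r : Res V ρ) (r₀ : Res V τ) (k₀ : Program V τ → Program V ρ)
      (k : Program V ρ → Program V ρ') (kv : Val V ρ → Res V ρ') (kv' : Val V τ → Res V ρ'),
      ¬ r₀.IsVal → (∀ kv₀, r = r₀.bind k₀ kv₀) →
      r.bind k kv = r₀.bind (fun P' => k (k₀ P')) kv' := by
    intro ρ ρ' r r₀ k₀ k kv kv' h₀ hr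
    cases r₀ with
    | val v => exact absurd ⟨v, rfl⟩ h₀
    | _ => rw [hr (fun _ => r)]; rfl
  induction E with
  | hole =>
    intro kv
    cases hP : next ev P with
    | val v => exact absurd ⟨v, hP⟩ h
    | _ => exact hP
  | fn f k M hM E ih =>
    intro kv
    change fnNext ev f (Function.update M k (E.plug P))
      (fun i => next ev (Function.update M k (E.plug P) i)) = _
    have hk : ¬ (next ev (E.plug P)).IsVal := by
      intro hv
      cases hP : next ev P with
      | val v => exact h ⟨v, hP⟩
      | _ =>
        obtain ⟨v, hv⟩ := hv
        rw [ih fun _ => .val v, hP] at hv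
        cases hv
    rw [fnNext_of_not_isVal ev f _ _ k (by simpa using hk) ?_ (fun _ => .step (.fn f M))]
    · simp only [Function.update_self, Function.update_idem]
      exact key _ _ _ (fun P' => .fn f (Function.update M k P')) _ _ h ih
    · intro i hi
      obtain ⟨c, hc⟩ := hM i hi
      rw [Function.update_of_ne hi.ne, hc]
      exact ⟨.con c, rfl⟩
  | ite E M N ih => exact fun kv => key _ _ _ (fun L => .ite L M N) _ _ h ih
  | reward E M ih => exact fun kv => key _ _ _ (fun L => .reward L M) _ _ h ih
  | pairL E N ih => exact fun kv => key _ _ _ (fun L => .pair L N) _ _ h ih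
  | pairR v E ih =>
    intro kv
    change pairNext (next ev v.toTm) (next ev (E.plug P)) (E.plug P) = _
    rw [next_toTm]
    exact key _ _ _ (fun L => .pair v.toTm L) _ _ h ih
  | fst E ih => exact fun kv => key _ _ _ .fst _ _ h ih
  | snd E ih => exact fun kv => key _ _ _ .snd _ _ h ih
  | appL E N ih => exact fun kv => key _ _ _ (fun L => .app L N) _ _ h ih
  | appR M E ih => exact fun kv => key _ _ _ (fun L => .app (.lam M) L) _ _ h ih

/-- `next` decides a conditional by testing for `tt`, so agreement on the `ff` redex needs the two
constants to differ. -/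
theorem next_redexStep (htf : V.tt ≠ V.ff) {σ : Ty V.B} {P P' : Program V σ}
    (h : RedexStep ev P P') : next ev P = .step P' := by
  cases h with
  | fn f c => exact fnNext_con ev f c
  | ite_tt M N => exact congrArg Res.step (if_pos rfl)
  | ite_ff M N => exact congrArg Res.step (if_neg htf.symm)
  | fst v w =>
    change fstNext (next ev (Val.pair v w).toTm) = _
    rw [next_toTm]; rfl
  | snd v w =>
    change sndNext (next ev (Val.pair v w).toTm) = _
    rw [next_toTm]; rfl
  | beta M v =>
    change appNext (next ev (.lam M)) (next ev v.toTm) v.toTm = _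
    rw [next_toTm]; rfl

theorem next_of_step (htf : V.tt ≠ V.ff) {σ : Ty V.B} {M M' : Program V σ}
    (h : Step ev M M') : next ev M = .step M' := by
  obtain @⟨_, E, P, P', h⟩ := h
  have h := next_redexStep ev htf h
  rw [next_plug ev E _ (by rintro ⟨v, hv⟩; rw [h] at hv; cases hv) (fun _ => .step (E.plug P)), h]
  rfl

/-- The result `r` has the transition with label `l` to `M`. -/
inductive Res.HasOp {σ : Ty V.B} : Res V σ → OpLabel V → Program V σ → Prop
  | or_zero (M N) : HasOp (.or M N) (.or 0) M
  | or_one (M N) : HasOp (.or M N) (.or 1) N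
  | reward (c M) : HasOp (.reward c M) (.reward c) M
  | prob_zero (p M N) : HasOp (.prob p M N) (.prob p 0) M
  | prob_one (p M N) : HasOp (.prob p M N) (.prob p 1) N

/-- An operation redex is not a value, so `next_plug` carries its answer, with the context wrapped
around each argument, out to the whole program. -/
theorem hasOp_of_opStep {σ : Ty V.B} {M M' : Program V σ} {l : OpLabel V}
    (h : OpStep M l M') : (next ev M).HasOp l M' := by
  obtain @⟨_, E, P, P', _, h⟩ := h
  have h : (next ev P).HasOp l P' := by
    cases h <;> constructor
  generalize hr : next ev P = r at h
  rw [next_plug ev E _ (by rintro ⟨v, hv⟩; rw [hr] at hv; subst hv; cases h)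
    (fun _ => .step (E.plug P)), hr]
  cases h <;> constructor

/-- Composition of evaluation contexts. -/
def EvalCtx.comp {ρ τ : Ty V.B} (E : EvalCtx V ρ τ) :
    {σ : Ty V.B} → EvalCtx V τ σ → EvalCtx V ρ σ
  | _, .hole => E
  | _, .fn f k M h E' => .fn f k M h (E.comp E')
  | _, .ite E' M N => .ite (E.comp E') M N
  | _, .reward E' M => .reward (E.comp E') M
  | _, .pairL E' N => .pairL (E.comp E') N
  | _, .pairR v E' => .pairR v (E.comp E')
  | _, .fst E' => .fst (E.comp E')
  | _, .snd E' => .snd (E.comp E')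
  | _, .appL E' N => .appL (E.comp E') N
  | _, .appR M E' => .appR M (E.comp E')

theorem EvalCtx.plug_comp {ρ τ σ : Ty V.B} (E : EvalCtx V ρ τ) (K : EvalCtx V τ σ)
    (P : Program V ρ) : (E.comp K).plug P = K.plug (E.plug P) := by
  induction K with
  | hole => rfl
  | _ => simp_all [EvalCtx.comp, EvalCtx.plug]

theorem Step.plug {σ τ : Ty V.B} (K : EvalCtx V τ σ) {M M' : Program V τ} (h : Step ev M M') :
    Step ev (K.plug M) (K.plug M') := by
  obtain ⟨E, h⟩ := h
  rw [← EvalCtx.plug_comp, ← EvalCtx.plug_comp]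
  exact ⟨_, h⟩

theorem OpStep.plug {σ τ : Ty V.B} (K : EvalCtx V τ σ) {M M' : Program V τ} {l : OpLabel V}
    (h : OpStep M l M') : OpStep (K.plug M) l (K.plug M') := by
  obtain ⟨E, h⟩ := h
  rw [← EvalCtx.plug_comp, ← EvalCtx.plug_comp]
  exact ⟨_, h⟩

/-- The result `r` describes transitions that `M` has. -/
def Res.Sound {σ : Ty V.B} (M : Program V σ) : Res V σ → Prop
  | .val v => M = v.toTm
  | .step M' => Step ev M M'
  | .or M₁ M₂ => OpStep M (.or 0) M₁ ∧ OpStep M (.or 1) M₂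
  | .reward c M' => OpStep M (.reward c) M'
  | .prob p M₁ M₂ => OpStep M (.prob p 0) M₁ ∧ OpStep M (.prob p 1) M₂

theorem Res.Sound.bind {σ τ : Ty V.B} {M : Program V τ} {r : Res V τ} (h : r.Sound ev M)
    (K : EvalCtx V τ σ) (kv : Val V τ → Res V σ)
    (hv : ∀ v, M = v.toTm → (kv v).Sound ev (K.plug M)) :
    (r.bind (fun P => K.plug P) kv).Sound ev (K.plug M) := by
  cases r with
  | val v => exact hv v h
  | step M' => exact Step.plug ev K h
  | or M₁ M₂ => exact ⟨h.1.plug K, h.2.plug K⟩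
  | reward c M' => exact OpStep.plug K h
  | prob p M₁ M₂ => exact ⟨h.1.plug K, h.2.plug K⟩

theorem Step.of_redex {σ : Ty V.B} {P P' : Program V σ} (h : RedexStep ev P P') :
    Step ev P P' := ⟨.hole, h⟩

/-- Progress: no closed program is stuck. Evaluation contexts are built outwards along the
induction, one frame at a time. That every Boolean constant is `tt` or `ff` makes each conditional
on a value a redex. -/
theorem next_sound (hb : ∀ c : V.Con .bool, c = V.tt ∨ c = V.ff) {σ : Ty V.B}
    (M : Program V σ) : (next ev M).Sound ev M := by
  induction M using Program.induction with
  | con c => exact rfl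
  | star => exact rfl
  | lam M => exact rfl
  | or M N => exact ⟨⟨.hole, .or_zero M N⟩, ⟨.hole, .or_one M N⟩⟩
  | prob p M N => exact ⟨⟨.hole, .prob_zero p M N⟩, ⟨.hole, .prob_one p M N⟩⟩
  | fn f M ih =>
    by_cases h : ∀ i, (next ev (M i)).IsVal
    · choose v hv using h
      have hM : M = fun i => .con (v i).toCon := by
        funext i
        have := ih i
        rw [hv i] at this
        rw [← Val.toTm_con]; exact this
      rw [hM, fnNext_con]
      exact Step.of_redex ev (.fn f _)
    · push Not at h
      -- The hole of the context goes to the leftmost argument that is not yet a value; the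
      -- arguments before it are then constants, as `EvalCtx.fn` requires.
      obtain ⟨k, hk, hmin⟩ := WellFounded.has_min wellFounded_lt
        {i | ¬ (next ev (M i)).IsVal} h
      have hmin : ∀ i < k, (next ev (M i)).IsVal := fun i hi => by
        by_contra hc; exact hmin i hc hi
      have := (ih k).bind ev (.fn f k M (fun i hi => by
        obtain ⟨v, hv⟩ := hmin i hi
        have := ih i
        rw [hv] at this
        exact ⟨v.toCon, by rw [← Val.toTm_con]; exact this⟩) .hole)
        (fun _ => .step (.fn f M)) (fun v hv => absurd ⟨v, by rw [hv, next_toTm]⟩ hk)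
      simp only [EvalCtx.plug, Function.update_eq_self] at this
      change (fnNext ev f M fun i => next ev (M i)).Sound ev _
      rwa [fnNext_of_not_isVal ev f M (fun i => next ev (M i)) k hk hmin (fun _ => .step (.fn f M))]
  | ite L M N ih =>
    refine ih.bind ev (.ite .hole M N) _ fun v hv => ?_
    subst hv
    cases v with | con c =>
    refine Step.of_redex ev ?_
    change RedexStep ev (.ite (.con c) M N) (@ite _ (c = V.tt) (Classical.dec _) M N)
    split_ifs with h
    · exact h ▸ .ite_tt M N
    · exact (hb c).resolve_left h ▸ .ite_ff M N
  | reward N M ih =>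
    refine ih.bind ev (.reward .hole M) _ fun v hv => ?_
    subst hv
    cases v with | con c => exact ⟨.hole, .reward c M⟩
  | pair M N ih ih' =>
    refine ih.bind ev (.pairL .hole N) _ fun v hv => ?_
    subst hv
    refine ih'.bind ev (.pairR v .hole) _ fun w hw => ?_
    subst hw
    exact rfl
  | fst M ih =>
    refine ih.bind ev (.fst .hole) _ fun v hv => ?_
    subst hv
    cases v with | pair v w => exact Step.of_redex ev (.fst v w)
  | snd M ih =>
    refine ih.bind ev (.snd .hole) _ fun v hv => ?_
    subst hv
    cases v with | pair v w => exact Step.of_redex ev (.snd v w)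
  | app M N ih ih' =>
    refine ih.bind ev (.appL .hole N) _ fun v hv => ?_
    subst hv
    cases v with | lam M =>
    refine ih'.bind ev (.appR M .hole) _ fun w hw => ?_
    subst hw
    exact Step.of_redex ev (.beta M w)

/-! ### Evaluation -/

/-- Evaluation by iterating `next`. -/
inductive Runs {σ : Ty V.B} : Program V σ → EffVal V σ → Prop
  | val {M v} (h : next ev M = .val v) : Runs M (.val v)
  | step {M M' E} (h : next ev M = .step M') (e : Runs M' E) : Runs M E
  | or {M M₁ M₂ E₁ E₂} (h : next ev M = .or M₁ M₂) (e₁ : Runs M₁ E₁) (e₂ : Runs M₂ E₂) :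
      Runs M (.or E₁ E₂)
  | reward {M c M' E} (h : next ev M = .reward c M') (e : Runs M' E) : Runs M (.reward c E)
  | prob {M p M₁ M₂ E₁ E₂} (h : next ev M = .prob p M₁ M₂) (e₁ : Runs M₁ E₁)
      (e₂ : Runs M₂ E₂) : Runs M (.prob p E₁ E₂)

theorem Runs.unique {σ : Ty V.B} {M : Program V σ} {E E' : EffVal V σ} (h : Runs ev M E)
    (h' : Runs ev M E') : E = E' := by
  induction h generalizing E' <;> cases h' <;> grind

theorem Evaluates.of_step {σ : Ty V.B} {M M' : Program V σ} {E : EffVal V σ}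
    (h : Step ev M M') (e : Evaluates ev M' E) : Evaluates ev M E := by
  have hb : ∀ {l M''}, BigOpStep ev M' l M'' → BigOpStep ev M l M'' :=
    fun ⟨N, h₁, h₂⟩ => ⟨N, .head h h₁, h₂⟩
  cases e with
  | val h' => exact .val (.head h h')
  | or h₁ h₂ e₁ e₂ => exact .or (hb h₁) (hb h₂) e₁ e₂
  | reward h e => exact .reward (hb h) e
  | prob h₁ h₂ e₁ e₂ => exact .prob (hb h₁) (hb h₂) e₁ e₂

theorem Runs.evaluates (hb : ∀ c : V.Con .bool, c = V.tt ∨ c = V.ff) {σ : Ty V.B}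
    {M : Program V σ} {E : EffVal V σ} (h : Runs ev M E) : Evaluates ev M E := by
  have big : ∀ {l} {M M' : Program V σ}, OpStep M l M' → BigOpStep ev M l M' :=
    fun h => ⟨_, .refl, h⟩
  induction h with
  | @val M v h =>
    have := next_sound ev hb M
    rw [h] at this
    obtain rfl : M = v.toTm := this
    exact .val .refl
  | @step M M' E h e ih =>
    have := next_sound ev hb M
    rw [h] at this
    exact ih.of_step ev this
  | @or M M₁ M₂ E₁ E₂ h e₁ e₂ ih₁ ih₂ =>
    have := next_sound ev hb M
    rw [h] at this
    exact .or (big this.1) (big this.2) ih₁ ih₂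
  | @reward M c M' E h e ih =>
    have := next_sound ev hb M
    rw [h] at this
    exact .reward (big this) ih
  | @prob M p M₁ M₂ E₁ E₂ h e₁ e₂ ih₁ ih₂ =>
    have := next_sound ev hb M
    rw [h] at this
    exact .prob (big this.1) (big this.2) ih₁ ih₂

theorem Runs.of_steps (htf : V.tt ≠ V.ff) {σ : Ty V.B} {M M' : Program V σ} {E : EffVal V σ}
    (h : Relation.ReflTransGen (Step ev) M M') (e : Runs ev M' E) : Runs ev M E := by
  induction h using Relation.ReflTransGen.head_induction_on with
  | refl => exact e
  | head h _ ih => exact .step (next_of_step ev htf h) ih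

/-- Both reductions follow the one path given by `next`, and neither can be prolonged. It is needed
because the two branches of an operation in `Evaluates` are reached through separately given
intermediate programs. -/
theorem steps_confluent (htf : V.tt ≠ V.ff) {σ : Ty V.B} {M N N' : Program V σ}
    (h : Relation.ReflTransGen (Step ev) M N) (h' : Relation.ReflTransGen (Step ev) M N')
    (hN : ∀ P, next ev N ≠ .step P) (hN' : ∀ P, next ev N' ≠ .step P) : N = N' := by
  induction h using Relation.ReflTransGen.head_induction_on with
  | refl =>
    rcases h'.cases_head with rfl | ⟨P, hP, _⟩
    · rfl
    · exact absurd (next_of_step ev htf hP) (hN _)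
  | head h _ ih =>
    have h := next_of_step ev htf h
    rcases h'.cases_head with rfl | ⟨P, hP, h''⟩
    · exact absurd h (hN' _)
    · have hP := next_of_step ev htf hP
      rw [h] at hP
      cases hP
      exact ih h''

theorem Evaluates.runs (htf : V.tt ≠ V.ff) {σ : Ty V.B} {M : Program V σ} {E : EffVal V σ}
    (h : Evaluates ev M E) : Runs ev M E := by
  induction h with
  | val h => exact .of_steps ev htf h (.val (next_toTm ev _))
  | or h₁ h₂ e₁ e₂ ih₁ ih₂ =>
    obtain ⟨N, hN, h₁⟩ := h₁
    obtain ⟨N', hN', h₂⟩ := h₂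
    have h₁ := hasOp_of_opStep ev h₁
    have h₂ := hasOp_of_opStep ev h₂
    obtain rfl := steps_confluent ev htf hN hN' (fun P hP => by rw [hP] at h₁; cases h₁)
      (fun P hP => by rw [hP] at h₂; cases h₂)
    refine .of_steps ev htf hN ?_
    generalize hr : next ev N = r at h₁ h₂
    cases h₁; cases h₂
    exact .or hr ih₁ ih₂
  | reward h e ih =>
    obtain ⟨N, hN, h⟩ := h
    have h := hasOp_of_opStep ev h
    refine .of_steps ev htf hN ?_
    generalize hr : next ev N = r at h
    cases h
    exact .reward hr ih
  | prob h₁ h₂ e₁ e₂ ih₁ ih₂ =>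
    obtain ⟨N, hN, h₁⟩ := h₁
    obtain ⟨N', hN', h₂⟩ := h₂
    have h₁ := hasOp_of_opStep ev h₁
    have h₂ := hasOp_of_opStep ev h₂
    obtain rfl := steps_confluent ev htf hN hN' (fun P hP => by rw [hP] at h₁; cases h₁)
      (fun P hP => by rw [hP] at h₂; cases h₂)
    refine .of_steps ev htf hN ?_
    generalize hr : next ev N = r at h₁ h₂
    cases h₁; cases h₂
    exact .prob hr ih₁ ih₂

end Operational

/-! ### Composition laws for renaming and substitution -/

section Substitution

variable {V : Vocabulary.{v}}

theorem Tm.rename_subst {Γ Δ Θ : List (Ty V.B)} {σ : Ty V.B} (M : Tm V Γ σ) (r : Ren V Γ Δ)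
    (s : Sub V Δ Θ) : (M.rename r).subst s = M.subst fun _ x => s _ (r _ x) := by
  induction M generalizing Δ Θ with
  | lam M ih =>
    simp only [Tm.rename, Tm.subst, ih]
    congr 2
    funext σ x
    cases x <;> rfl
  | _ => simp_all [Tm.rename, Tm.subst]

theorem Tm.rename_eq_subst {Γ Δ : List (Ty V.B)} {σ : Ty V.B} (M : Tm V Γ σ) (r : Ren V Γ Δ) :
    M.rename r = M.subst fun _ x => .var (r _ x) := by
  induction M generalizing Δ with
  | lam M ih =>
    simp only [Tm.rename, Tm.subst, ih]
    congr 2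
    funext σ x
    cases x <;> rfl
  | _ => simp_all [Tm.rename, Tm.subst]

/-- Under a binder, two composites of a renaming with a weakening must agree. Both are rewritten as
substitutions of variables and fused by `Tm.rename_subst`, which avoids a separate law for composing
renamings. -/
theorem Tm.subst_rename {Γ Δ Θ : List (Ty V.B)} {σ : Ty V.B} (M : Tm V Γ σ) (s : Sub V Γ Δ)
    (r : Ren V Δ Θ) : (M.subst s).rename r = M.subst fun _ x => (s _ x).rename r := by
  induction M generalizing Δ Θ with
  | lam M ih =>
    simp only [Tm.rename, Tm.subst, ih]
    congr 2
    funext σ x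
    cases x with
    | zero => rfl
    | succ x =>
      exact (Tm.rename_eq_subst _ (r.lift _)).trans <| (Tm.rename_subst (s _ x) _ _).trans
        ((Tm.rename_eq_subst ((s _ x).rename r) _).trans (Tm.rename_subst _ _ _)).symm
  | _ => simp_all [Tm.rename, Tm.subst]

theorem Tm.subst_subst {Γ Δ Θ : List (Ty V.B)} {σ : Ty V.B} (M : Tm V Γ σ) (s : Sub V Γ Δ)
    (t : Sub V Δ Θ) : (M.subst s).subst t = M.subst fun _ x => (s _ x).subst t := by
  induction M generalizing Δ Θ with
  | lam M ih =>
    simp only [Tm.subst, ih]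
    congr 2
    funext σ x
    cases x with
    | zero => rfl
    | succ x =>
      exact (Tm.rename_subst (s _ x) _ _).trans (Tm.subst_rename (s _ x) _ _).symm
  | _ => simp_all [Tm.subst]

theorem Tm.subst_var {Γ : List (Ty V.B)} {σ : Ty V.B} (M : Tm V Γ σ) :
    M.subst (fun _ x => .var x) = M := by
  have : ∀ {Γ : List (Ty V.B)} (τ : Ty V.B),
      Sub.lift (V := V) (Γ := Γ) (fun _ x => .var x) τ = fun _ x => .var x := by
    intro Γ τ
    funext σ x
    cases x <;> rfl
  induction M with
  | _ => simp_all [Tm.subst]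

theorem Tm.subst_closed {σ : Ty V.B} (M : Program V σ) (s : Sub V [] []) : M.subst s = M := by
  conv_rhs => rw [← Tm.subst_var M]
  congr 1
  funext σ x
  cases x

/-- Extension of a closing substitution by a closed term. -/
def Sub.cons {Γ : List (Ty V.B)} {τ : Ty V.B} (N : Program V τ) (s : Sub V Γ []) :
    Sub V (τ :: Γ) []
  | _, .zero => N
  | _, .succ x => s _ x

theorem Tm.subst_lift_inst {Γ : List (Ty V.B)} {σ τ : Ty V.B} (M : Tm V (τ :: Γ) σ)
    (s : Sub V Γ []) (N : Program V τ) : (M.subst (s.lift τ)).inst N = M.subst (s.cons N) := by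
  rw [Tm.inst, Tm.subst_subst]
  congr 1
  funext ρ x
  cases x with
  | zero => rfl
  | succ x =>
    exact (Tm.rename_subst (s _ x) _ _).trans (Tm.subst_closed _ _)

end Substitution

/-! ### Termination by reducibility -/

section Termination

variable {V : Vocabulary.{v}} (ev : FnEval V)

/-- All runs of `M` end in values that satisfy `P`. -/
inductive Comp {σ : Ty V.B} (P : Val V σ → Prop) : Program V σ → Prop
  | val {M v} (h : next ev M = .val v) (hv : P v) : Comp P M
  | step {M M'} (h : next ev M = .step M') (e : Comp P M') : Comp P M
  | or {M M₁ M₂} (h : next ev M = .or M₁ M₂) (e₁ : Comp P M₁) (e₂ : Comp P M₂) : Comp P M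
  | reward {M c M'} (h : next ev M = .reward c M') (e : Comp P M') : Comp P M
  | prob {M p M₁ M₂} (h : next ev M = .prob p M₁ M₂) (e₁ : Comp P M₁) (e₂ : Comp P M₂) :
      Comp P M

/-- Reducible values. -/
def VRed : (σ : Ty V.B) → Val V σ → Prop
  | .base _, _ => True
  | .unit, _ => True
  | .prod σ τ, v => VRed σ v.fst ∧ VRed τ v.snd
  | .arrow σ τ, v => ∀ w, VRed σ w → Comp ev (VRed τ) (v.body.inst w.toTm)

variable {ev}

theorem Comp.of_val {σ : Ty V.B} {P : Val V σ → Prop} {v : Val V σ} (h : P v) :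
    Comp ev P v.toTm := .val (next_toTm ev v) h

theorem Comp.exists_runs {σ : Ty V.B} {P : Val V σ → Prop} {M : Program V σ} (h : Comp ev P M) :
    ∃ E, Runs ev M E := by
  induction h with
  | val h _ => exact ⟨_, .val h⟩
  | step h _ ih => obtain ⟨E, ih⟩ := ih; exact ⟨E, .step h ih⟩
  | or h _ _ ih₁ ih₂ =>
    obtain ⟨E, ih₁⟩ := ih₁
    obtain ⟨E', ih₂⟩ := ih₂
    exact ⟨_, .or h ih₁ ih₂⟩
  | reward h _ ih => obtain ⟨E, ih⟩ := ih; exact ⟨_, .reward h ih⟩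
  | prob h _ _ ih₁ ih₂ =>
    obtain ⟨E, ih₁⟩ := ih₁
    obtain ⟨E', ih₂⟩ := ih₂
    exact ⟨_, .prob h ih₁ ih₂⟩

/-- The bind principle of the reducibility argument: the context waits while its hole computes, in
all branches, and takes over at each resulting value. -/
theorem Comp.plug (hb : ∀ c : V.Con .bool, c = V.tt ∨ c = V.ff) {σ τ : Ty V.B}
    {P : Val V τ → Prop} {Q : Val V σ → Prop} (E : EvalCtx V τ σ) {M : Program V τ}
    (h : Comp ev P M) (hE : ∀ v, P v → Comp ev Q (E.plug v.toTm)) : Comp ev Q (E.plug M) := by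
  have key : ∀ {M}, ¬ (next ev M).IsVal → ∀ r : Res V τ, next ev M = r →
      next ev (E.plug M) = r.bind (fun P' => E.plug P') fun _ => .step (E.plug M) :=
    fun h r hr => hr ▸ next_plug ev E _ h _
  induction h with
  | @val M v h hv =>
    have := next_sound ev hb M
    rw [h] at this
    obtain rfl : M = v.toTm := this
    exact hE v hv
  | step h _ ih => exact .step (key (by simp [Res.IsVal, h]) _ h) ih
  | or h _ _ ih₁ ih₂ => exact .or (key (by simp [Res.IsVal, h]) _ h) ih₁ ih₂
  | reward h _ ih => exact .reward (key (by simp [Res.IsVal, h]) _ h) ih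
  | prob h _ _ ih₁ ih₂ => exact .prob (key (by simp [Res.IsVal, h]) _ h) ih₁ ih₂

/-- If all arguments are computable, then so is the application of a function symbol. -/
theorem Comp.fn (hb : ∀ c : V.Con .bool, c = V.tt ∨ c = V.ff) (f : FnSym V) (k : ℕ) :
    ∀ (M : ∀ i, Program V (.base (f.dom i))),
    (∀ i : Fin f.arity, (i : ℕ) + k < f.arity → ∃ c, M i = .con c) →
    (∀ i, Comp ev (VRed ev _) (M i)) → k ≤ f.arity → Comp ev (VRed ev _) (.fn f M) := by
  induction k with
  | zero =>
    intro M hM _ _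
    choose c hc using fun i : Fin f.arity => hM i (by simp)
    obtain rfl : M = fun i => .con (c i) := funext hc
    exact .step (fnNext_con ev f c) (.of_val (v := .con (ev.val f c)) trivial)
  | succ k ih =>
    intro M hM h hk
    -- Here `k + 1` arguments are left to evaluate, so the next one sits at position `arity - (k +
    -- 1)`. Replacing it by a constant leaves `k`.
    let j : Fin f.arity := ⟨f.arity - (k + 1), by omega⟩
    have := (h j).plug hb (Q := VRed ev _) (.fn f j M (fun i hi => hM i (by
      have : (i : ℕ) < f.arity - (k + 1) := hi
      omega)) .hole) fun v _ => by
        refine ih _ (fun i hi => ?_) (fun i => ?_) (by omega)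
        · by_cases hij : i = j
          · subst hij
            exact ⟨v.toCon, by rw [EvalCtx.plug, Function.update_self, Val.toTm_con]⟩
          · rw [Function.update_of_ne hij]
            refine hM i ?_
            have : (i : ℕ) ≠ f.arity - (k + 1) := fun h => hij (Fin.ext h)
            omega
        · by_cases hij : i = j
          · subst hij
            rw [EvalCtx.plug, Function.update_self]
            exact .of_val trivial
          · rw [Function.update_of_ne hij]
            exact h i
    simpa [EvalCtx.plug] using this

/-- The fundamental lemma of the logical relation, by induction on open terms closed by reducible
values. For an abstraction, instantiating its body after substitution is one larger closing
substitution, to which the induction hypothesis applies. -/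
theorem comp_subst (hb : ∀ c : V.Con .bool, c = V.tt ∨ c = V.ff) {Γ : List (Ty V.B)}
    {σ : Ty V.B} (M : Tm V Γ σ) (s : Sub V Γ [])
    (hs : ∀ τ x, ∃ v : Val V τ, VRed ev τ v ∧ s τ x = v.toTm) :
    Comp ev (VRed ev σ) (M.subst s) := by
  induction M with
  | var x => 
    obtain ⟨v, hv, h⟩ := hs _ x
    rw [Tm.subst, h]
    exact .of_val hv
  | con c => exact .of_val (v := .con c) trivial
  | star => exact .of_val (v := .star) trivial
  | fn f M ih =>
    exact .fn hb f f.arity _ (fun i hi => by omega) (fun i => ih i s hs) le_rfl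
  | ite L M N ihL ihM ihN =>
    refine (ihL s hs).plug hb (.ite .hole (M.subst s) (N.subst s)) fun v _ => ?_
    cases v with | con c =>
    refine .step (M' := @ite _ (c = V.tt) (Classical.dec _) (M.subst s) (N.subst s)) ?_ ?_
    · rfl
    · split_ifs
      exacts [ihM s hs, ihN s hs]
  | or M N ihM ihN => exact .or rfl (ihM s hs) (ihN s hs)
  | reward N M ihN ihM =>
    refine (ihN s hs).plug hb (.reward .hole (M.subst s)) fun v _ => ?_
    cases v with | con c => exact .reward rfl (ihM s hs)
  | prob p M N ihM ihN => exact .prob rfl (ihM s hs) (ihN s hs)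
  | pair M N ihM ihN =>
    refine (ihM s hs).plug hb (.pairL .hole (N.subst s)) fun v hv => ?_
    refine (ihN s hs).plug hb (.pairR v .hole) fun w hw => ?_
    exact .of_val (v := .pair v w) ⟨hv, hw⟩
  | fst M ih =>
    refine (ih s hs).plug hb (.fst .hole) fun v hv => ?_
    refine .step (M' := v.fst.toTm) ?_ (.of_val hv.1)
    change fstNext (next ev v.toTm) = _
    rw [next_toTm]; rfl
  | snd M ih =>
    refine (ih s hs).plug hb (.snd .hole) fun v hv => ?_
    refine .step (M' := v.snd.toTm) ?_ (.of_val hv.2)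
    change sndNext (next ev v.toTm) = _
    rw [next_toTm]; rfl
  | @lam Γ σ τ M ih =>
    refine .of_val (v := .lam (M.subst (s.lift _))) fun w hw => ?_
    change Comp ev _ ((M.subst (s.lift σ)).inst w.toTm)
    rw [Tm.subst_lift_inst]
    refine ih _ fun ρ x => ?_
    cases x with
    | zero => exact ⟨w, hw, rfl⟩
    | succ x => exact hs ρ x
  | app M N ihM ihN =>
    refine (ihM s hs).plug hb (.appL .hole (N.subst s)) fun v hv => ?_
    cases v with | lam L =>
    refine (ihN s hs).plug hb (.appR L .hole) fun w hw => ?_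
    refine .step (M' := L.inst w.toTm) ?_ (hv w hw)
    change appNext (next ev (.lam L)) (next ev w.toTm) w.toTm = _
    rw [next_toTm]; rfl

theorem exists_runs (hb : ∀ c : V.Con .bool, c = V.tt ∨ c = V.ff) {σ : Ty V.B}
    (M : Program V σ) : ∃ E, Runs ev M E := by
  have := comp_subst (ev := ev) hb M (fun _ x => .var x) (fun _ x => by cases x)
  rw [Tm.subst_var] at this
  exact this.exists_runs

theorem existsUnique_evaluates (hb : ∀ c : V.Con .bool, c = V.tt ∨ c = V.ff)
    (htf : V.tt ≠ V.ff) {σ : Ty V.B} (M : Program V σ) : ∃! E, Evaluates ev M E := by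
  obtain ⟨E, hE⟩ := exists_runs (ev := ev) hb M
  exact ⟨E, hE.evaluates ev hb, fun E' hE' => (hE'.runs ev htf).unique ev hE⟩

end Termination

/-! ### Barycentric algebras, their cones, and convex combinations -/

section Barycentric

open Convexity

/-- `φ w x` behaves like the multiple `w • x` of `x`, for `w ≥ 0`, in an additive monoid. -/
structure IsConeMap {A M : Type*} [AddCommMonoid M] (comb : Prob → A → A → A)
    (φ : ℝ → A → M) : Prop where
  zero : ∀ x, φ 0 x = 0
  add : ∀ v w x, 0 ≤ v → 0 ≤ w → φ (v + w) x = φ v x + φ w x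
  comb : ∀ w p x y, 0 ≤ w → φ w (comb p x y) = φ (w * p) x + φ (w * (1 - p)) y

theorem IsConeMap.comp {A B M : Type*} [AddCommMonoid M] {comb : Prob → A → A → A}
    {comb' : Prob → B → B → B} {φ : ℝ → B → M} (hφ : IsConeMap comb' φ) {h : A → B}
    (hh : ∀ p x y, h (comb p x y) = comb' p (h x) (h y)) :
    IsConeMap comb fun w x => φ w (h x) where
  zero _ := hφ.zero _
  add _ _ _ hv hw := hφ.add _ _ _ hv hw
  comb _ _ _ _ hw := by rw [hh, hφ.comb _ _ _ _ hw]

/-- Applying the injective `φ 1` turns each barycentric equation into an equality of two sums with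
the same points; only the real coefficients have to be compared. This yields the axioms for mixtures
of distributions and for `T2`. -/
theorem IsConeMap.isBarycentric {A M : Type*} [AddCommMonoid M] {comb : Prob → A → A → A}
    {φ : ℝ → A → M} (hφ : IsConeMap comb φ) (hinj : Function.Injective (φ 1)) :
    IsBarycentric comb where
  comb_one x y := hinj (by simp [hφ.comb, hφ.zero])
  comb_self p x := hinj (by
    rw [hφ.comb _ _ _ _ zero_le_one, ← hφ.add _ _ _ (by simpa using p.2.1)
      (by simpa using p.2.2)]
    congr 1; ring)
  comb_symm p x y := hinj (by
    rw [hφ.comb _ _ _ _ zero_le_one, hφ.comb _ _ _ _ zero_le_one, add_comm]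
    simp)
  comb_assoc p q s x y z hp hq hs := hinj (by
    have hp' : (p : ℝ) < 1 := hp
    have hq' : (q : ℝ) < 1 := hq
    have hp0 : (0 : ℝ) ≤ p := p.2.1
    have hq0 : (0 : ℝ) ≤ q := q.2.1
    have hpq : (p : ℝ) * q < 1 := by nlinarith
    have h1 : (1 - (q : ℝ) * p) ≠ 0 := by linarith [mul_comm (p : ℝ) q]
    rw [hφ.comb _ _ _ _ zero_le_one, hφ.comb _ _ _ _ zero_le_one,
      hφ.comb _ _ _ _ (by simpa using hq0), hφ.comb _ _ _ _ (by simp; linarith), ← add_assoc]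
    simp only [one_mul, Set.Icc.coe_mul, hs, mul_comm (p : ℝ) q]
    congr 2
    · congr 1; field_simp
    · field_simp; ring)

/-! ### The cone of a barycentric algebra -/

/-- The cone of a barycentric algebra: zero, and positive multiples of points. -/
def BaryCone {A : Type*} {comb : Prob → A → A → A} (_ : IsBarycentric comb) : Type _ :=
  Option (Set.Ioi (0 : ℝ) × A)

namespace BaryCone

variable {A : Type*} {comb : Prob → A → A → A} {h : IsBarycentric comb}

/-- The fraction `v / (v + w)`. -/
noncomputable def frac (v w : Set.Ioi (0 : ℝ)) : Prob :=
  ⟨v / (v + w), div_nonneg v.2.le (add_nonneg v.2.le w.2.le),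
    (div_le_one (add_pos v.2 w.2)).2 (le_add_of_nonneg_right w.2.le)⟩

noncomputable def addW (v w : Set.Ioi (0 : ℝ)) : Set.Ioi (0 : ℝ) := ⟨v + w, Set.mem_Ioi.2 (add_pos v.2 w.2)⟩

noncomputable def add : BaryCone h → BaryCone h → BaryCone h
  | none, b => b
  | some a, none => some a
  | some a, some b => some (addW a.1 b.1, comb (frac a.1 b.1) a.2 b.2)

noncomputable instance : Zero (BaryCone h) := ⟨none⟩

noncomputable instance : Add (BaryCone h) := ⟨add⟩

/-- Commutativity of the sum is the symmetry axiom, and associativity is skew associativity with `s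
= w / (w + u)`. All weights being strictly positive, every fraction is below 1, so that axiom
applies. -/
noncomputable instance : AddCommMonoid (BaryCone h) where
  zero_add a := rfl
  add_zero a := by cases a <;> rfl
  add_comm a b := by
    rcases a with _ | ⟨v, x⟩ <;> rcases b with _ | ⟨w, y⟩ <;> try rfl
    have hv : 0 < (v : ℝ) := v.2
    have hw : 0 < (w : ℝ) := w.2
    refine congrArg some (Prod.ext (Subtype.ext (add_comm (v : ℝ) w)) ?_)
    change comb (frac v w) x y = comb (frac w v) y x
    rw [h.comb_symm]
    congr 1
    apply Subtype.ext
    simp only [frac, unitInterval.coe_symm_eq]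
    field_simp
    ring
  add_assoc a b c := by
    rcases a with _ | ⟨v, x⟩ <;> rcases b with _ | ⟨w, y⟩ <;> rcases c with _ | ⟨u, z⟩ <;> try rfl
    have hv : 0 < (v : ℝ) := v.2
    have hw : 0 < (w : ℝ) := w.2
    have hu : 0 < (u : ℝ) := u.2
    have hlt : ∀ a b : Set.Ioi (0 : ℝ), frac a b < 1 := fun a b =>
      Subtype.coe_lt_coe.1 ((div_lt_one (add_pos a.2 b.2)).2 (lt_add_of_pos_right (a : ℝ) b.2))
    refine congrArg some (Prod.ext (Subtype.ext (add_assoc (v : ℝ) w u)) ?_)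
    change comb (frac (addW v w) u) (comb (frac v w) x y) z =
      comb (frac v (addW w u)) x (comb (frac w u) y z)
    rw [h.comb_assoc (frac v w) (frac (addW v w) u) (frac w u) x y z (hlt _ _) (hlt _ _)]
    · congr 1
      apply Subtype.ext
      simp only [frac, addW, Set.Icc.coe_mul]
      field_simp
      ring
    · simp only [frac, addW]
      have : 1 - (v : ℝ) / (v + w) * ((v + w) / (v + w + u)) = (w + u) / (v + w + u) := by
        field_simp
        ring
      rw [this]
      field_simp
      ring
  nsmul := nsmulRec

/-- The multiple `w • x`. -/
noncomputable def mk (h : IsBarycentric comb) (w : ℝ) (x : A) : BaryCone h :=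
  if hw : 0 < w then some (⟨w, hw⟩, x) else none

theorem mk_of_pos {w : ℝ} (hw : 0 < w) (x : A) : mk h w x = some (⟨w, hw⟩, x) := dif_pos hw

theorem mk_zero (x : A) : mk h 0 x = 0 := dif_neg (lt_irrefl _)

theorem mk_injective {w : ℝ} (hw : 0 < w) : Function.Injective (mk h w) := by
  intro x y hxy
  rw [mk_of_pos hw, mk_of_pos hw] at hxy
  exact congrArg Prod.snd (Option.some.inj hxy)

theorem mk_add_mk {v w : ℝ} (hv : 0 < v) (hw : 0 < w) (x y : A) :
    mk h v x + mk h w y = mk h (v + w) (comb (frac ⟨v, hv⟩ ⟨w, hw⟩) x y) := by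
  rw [mk_of_pos hv, mk_of_pos hw, mk_of_pos (add_pos hv hw)]
  rfl

theorem isConeMap (h : IsBarycentric comb) : IsConeMap comb (mk h) where
  zero := mk_zero
  add v w x hv hw := by
    rcases hv.eq_or_lt with rfl | hv
    · rw [mk_zero, zero_add, zero_add]
    rcases hw.eq_or_lt with rfl | hw
    · rw [mk_zero, add_zero, add_zero]
    rw [mk_add_mk hv hw, h.comb_self]
  comb w p x y hw := by
    rcases hw.eq_or_lt with rfl | hw
    · simp [mk_zero]
    have h1 : ∀ x y, comb 1 x y = x := h.comb_one
    -- At `p = 0` or `p = 1` one summand has weight zero and is the zero of the cone, so `mk_add_mk`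
    -- covers only the interior.
    rcases p.2.1.eq_or_lt with hp | hp
    · obtain rfl : p = 0 := Subtype.ext hp.symm
      rw [h.comb_symm]
      simp [mk_zero, h1]
    rcases p.2.2.eq_or_lt with hp' | hp'
    · obtain rfl : p = 1 := Subtype.ext hp'
      simp [mk_zero, h1]
    rw [mk_add_mk (mul_pos hw hp) (mul_pos hw (sub_pos.2 hp'))]
    congr 1
    · ring
    · congr 1
      apply Subtype.ext
      simp only [frac]
      field_simp
      ring

/-- The additive map that a cone map induces. -/
noncomputable def lift (h : IsBarycentric comb) {M : Type*} [AddCommMonoid M] {φ : ℝ → A → M}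
    (hφ : IsConeMap comb φ) : BaryCone h →+ M where
  toFun
    | none => 0
    | some a => φ a.1 a.2
  map_zero' := rfl
  map_add' a b := by
    rcases a with _ | ⟨v, x⟩
    · exact (zero_add _).symm
    rcases b with _ | ⟨w, y⟩
    · exact (add_zero _).symm
    have hv : 0 < (v : ℝ) := v.2
    have hw : 0 < (w : ℝ) := w.2
    refine (hφ.comb _ _ _ _ (addW v w).2.le).trans ?_
    simp only [frac, addW]
    congr 2
    · field_simp
    · field_simp; ring

theorem lift_mk (h : IsBarycentric comb) {M : Type*} [AddCommMonoid M] {φ : ℝ → A → M}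
    (hφ : IsConeMap comb φ) {w : ℝ} (hw : 0 ≤ w) (x : A) : lift h hφ (mk h w x) = φ w x := by
  rcases hw.eq_or_lt with rfl | hw
  · rw [mk_zero, map_zero, hφ.zero]
  · rw [mk_of_pos hw]; rfl

end BaryCone

/-! ### Convex combinations -/

/-- At each stage the total weight cancels the normalizing denominator: the head keeps weight `c * w
z`, and the tail keeps `c` times its own total. In the cone the iterated mean is therefore a plain
weighted sum. -/
theorem IsConeMap.listMean {A M Z : Type*} [AddCommMonoid M] {comb : Prob → A → A → A}
    {φ : ℝ → A → M} (hφ : IsConeMap comb φ) (w : Z → ℝ) (f : Z → A) (c : ℝ) (hc : 0 ≤ c)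
    (l : List Z) (hl : l ≠ []) (hw : ∀ z ∈ l, 0 < w z) :
    φ (c * (l.map w).sum) (listMean comb w f l hl) = (l.map fun z => φ (c * w z) (f z)).sum := by
  induction l with
  | nil => exact absurd rfl hl
  | cons z l ih =>
    cases l with
    | nil => simp [SelLang.listMean]
    | cons y l =>
      have hz : 0 < w z := hw z (by simp)
      have hpos : 0 ≤ ((y :: l).map w).sum := List.sum_nonneg (by
        intro a ha
        obtain ⟨b, hb, rfl⟩ := List.mem_map.1 ha
        exact (hw b (List.mem_cons_of_mem _ hb)).le)
      have ih := ih (List.cons_ne_nil y l) fun z hz => hw z (List.mem_cons_of_mem _ hz)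
      generalize hS : ((y :: l).map w).sum = S at ih hpos
      have hS' : ((z :: y :: l).map w).sum = w z + S := by rw [← hS]; simp
      have hmem : w z / (w z + S) ∈ Set.Icc (0 : ℝ) 1 :=
        ⟨by positivity, (div_le_one (by positivity)).2 (by linarith)⟩
      rw [SelLang.listMean, hφ.comb _ _ _ _ (by rw [hS']; positivity), hS',
        Set.projIcc_of_mem _ hmem]
      have e1 : c * (w z + S) * (w z / (w z + S)) = c * w z := by field_simp
      have e2 : c * (w z + S) * (1 - w z / (w z + S)) = c * S := by field_simp; ring
      simp only [e1, e2, ih, List.map_cons, List.sum_cons]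

/-- The right-hand side no longer mentions an enumeration of the support. Enlarging the support to
any finite `S` adds only zeros, which allows several distributions to be summed over one index set.
-/
theorem IsConeMap.convexSum {A M Z : Type*} [AddCommMonoid M] {comb : Prob → A → A → A}
    {φ : ℝ → A → M} (hφ : IsConeMap comb φ) {c : ℝ} (hc : 0 ≤ c) (μ : StdSimplex ℝ Z)
    (f : Z → A) {S : Finset Z} (hS : μ.weights.support ⊆ S) :
    φ c (convexSum comb μ f) = ∑ z ∈ S, φ (c * μ.weights z) (f z) := by
  have := hφ.listMean μ.weights f c hc _ (support_toList_ne_nil μ) (by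
    intro z hz
    rw [Finset.mem_toList, Finsupp.mem_support_iff] at hz
    exact lt_of_le_of_ne (μ.nonneg z) hz.symm)
  rw [Finset.sum_map_toList, Finset.sum_map_toList] at this
  have htot : ∑ z ∈ μ.weights.support, μ.weights z = 1 := μ.total
  rw [htot, mul_one] at this
  rw [SelLang.convexSum, this]
  refine Finset.sum_subset hS fun z _ hz => ?_
  rw [Finsupp.notMem_support_iff.1 hz, mul_zero, hφ.zero]

theorem weights_mix {Z : Type*} (p : Prob) (μ ν : StdSimplex ℝ Z) :
    (mix p μ ν).weights = (p : ℝ) • μ.weights + (1 - p : ℝ) • ν.weights :=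
  StdSimplex.weights_convexCombPair ..

theorem isConeMap_mix (Z : Type*) :
    IsConeMap (A := StdSimplex ℝ Z) mix fun w μ => w • μ.weights where
  zero _ := zero_smul _ _
  add _ _ _ _ _ := add_smul _ _ _
  comb w p μ ν _ := by rw [weights_mix, smul_add, smul_smul, smul_smul]

theorem isBarycentric_mix (Z : Type*) : IsBarycentric (A := StdSimplex ℝ Z) mix :=
  (isConeMap_mix Z).isBarycentric fun μ ν h => by simpa using h

section

variable {A Z : Type*} {comb : Prob → A → A → A}

theorem convexSum_single (h : IsBarycentric comb) (z : Z) (f : Z → A) :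
    convexSum comb (StdSimplex.single z) f = f z := by
  classical
  apply BaryCone.mk_injective (h := h) zero_lt_one
  rw [(BaryCone.isConeMap h).convexSum zero_le_one (S := {z}) _ _ (by simp)]
  simp

theorem support_mix_subset [DecidableEq Z] (p : Prob) (μ ν : StdSimplex ℝ Z) :
    (mix p μ ν).weights.support ⊆ μ.weights.support ∪ ν.weights.support := by
  intro z hz
  by_contra hcon
  simp only [Finset.mem_union, Finsupp.mem_support_iff, not_or, not_not] at hcon
  simp [weights_mix, hcon.1, hcon.2] at hz

/-- In the cone, both sides are sums over the union of the two supports, and they agree term by term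
by additivity in the weight. -/
theorem convexSum_mix (h : IsBarycentric comb) (p : Prob) (μ ν : StdSimplex ℝ Z) (f : Z → A) :
    convexSum comb (mix p μ ν) f = comb p (convexSum comb μ f) (convexSum comb ν f) := by
  classical
  have hφ := BaryCone.isConeMap h
  apply BaryCone.mk_injective (h := h) zero_lt_one
  have hp : (0 : ℝ) ≤ p := p.2.1
  have hp' : (0 : ℝ) ≤ 1 - p := sub_nonneg.2 p.2.2
  rw [hφ.comb _ _ _ _ zero_le_one, one_mul, one_mul,
    hφ.convexSum hp μ _ Finset.subset_union_left, hφ.convexSum hp' ν _ Finset.subset_union_right,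
    hφ.convexSum zero_le_one _ _ (support_mix_subset p μ ν), ← Finset.sum_add_distrib]
  refine Finset.sum_congr rfl fun z _ => ?_
  rw [weights_mix, ← hφ.add _ _ _ (mul_nonneg hp (μ.nonneg z)) (mul_nonneg hp' (ν.nonneg z)),
    one_mul]
  rfl

theorem convexSum_congr (μ : StdSimplex ℝ Z) {f g : Z → A}
    (h : ∀ z, μ.weights z ≠ 0 → f z = g z) : convexSum comb μ f = convexSum comb μ g := by
  have key : ∀ (l : List Z) (hl : l ≠ []), (∀ z ∈ l, f z = g z) →
      listMean comb μ.weights f l hl = listMean comb μ.weights g l hl := by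
    intro l
    induction l with
    | nil => exact fun hl => absurd rfl hl
    | cons z l ih =>
      intro hl h
      cases l with
      | nil => exact h z (by simp)
      | cons y l => rw [listMean, listMean, h z (by simp),
          ih _ fun z hz => h z (List.mem_cons_of_mem _ hz)]
  exact key _ _ fun z hz => h z (by simpa using hz)

theorem listMean_mem {P : A → Prop} (hP : ∀ p x y, P x → P y → P (comb p x y)) (w : Z → ℝ)
    {f : Z → A} (hf : ∀ z, P (f z)) (l : List Z) (hl : l ≠ []) : P (listMean comb w f l hl) := by
  induction l with
  | nil => exact absurd rfl hl
  | cons z l ih =>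
    cases l with
    | nil => exact hf z
    | cons y l => exact hP _ _ _ (hf z) (ih _)

theorem convexSum_mem {P : A → Prop} (hP : ∀ p x y, P x → P y → P (comb p x y))
    (μ : StdSimplex ℝ Z) {f : Z → A} (hf : ∀ z, P (f z)) : P (convexSum comb μ f) :=
  listMean_mem hP _ hf _ _

theorem map_listMean {B : Type*} {comb' : Prob → B → B → B} {h : A → B}
    (hh : ∀ p x y, h (comb p x y) = comb' p (h x) (h y)) (w : Z → ℝ) (f : Z → A) (l : List Z)
    (hl : l ≠ []) : h (listMean comb w f l hl) = listMean comb' w (fun z => h (f z)) l hl := by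
  induction l with
  | nil => exact absurd rfl hl
  | cons z l ih =>
    cases l with
    | nil => rfl
    | cons y l => rw [listMean, listMean, hh, ih]

theorem map_convexSum {B : Type*} {comb' : Prob → B → B → B} {h : A → B}
    (hh : ∀ p x y, h (comb p x y) = comb' p (h x) (h y)) (μ : StdSimplex ℝ Z) (f : Z → A) :
    h (convexSum comb μ f) = convexSum comb' μ (fun z => h (f z)) :=
  map_listMean hh _ _ _ _

theorem convexSum_mix_single (μ : StdSimplex ℝ Z) :
    convexSum mix μ StdSimplex.single = μ := by
  have := (isConeMap_mix Z).convexSum zero_le_one μ StdSimplex.single subset_rfl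
  simp only [one_smul, one_mul] at this
  ext1
  rw [this]
  conv_rhs => rw [← Finsupp.sum_single μ.weights]
  simp [Finsupp.sum]

/-- A distribution is the convex combination of its own point masses, and convex combinations stay
inside any predicate closed under binary mixing. Homomorphism properties can thus be checked without
handling sums. -/
theorem stdSimplex_induction {P : StdSimplex ℝ Z → Prop}
    (single : ∀ z, P (StdSimplex.single z)) (mix : ∀ p μ ν, P μ → P ν → P (mix p μ ν))
    (μ : StdSimplex ℝ Z) : P μ := by
  rw [← convexSum_mix_single μ]
  exact convexSum_mem mix μ single

end

theorem map_mix {Y Z : Type*} (g : Y → Z) (p : Prob) (μ ν : StdSimplex ℝ Y) :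
    (mix p μ ν).map g = mix p (μ.map g) (ν.map g) := by
  ext1
  simp [weights_mix, Finsupp.mapDomain_add, Finsupp.mapDomain_smul]

theorem mix_one {Z : Type*} (μ ν : StdSimplex ℝ Z) : mix 1 μ ν = μ :=
  (isBarycentric_mix Z).comb_one μ ν

theorem IsBarycentric.comb_zero {A : Type*} {comb : Prob → A → A → A} (h : IsBarycentric comb)
    (x y : A) : comb 0 x y = y := by
  rw [h.comb_symm, unitInterval.symm_zero, h.comb_one]

/-! ### The distribution-writer functor -/

variable {R : Type u} [RewardSpace R]

theorem RewardSpace.isModule : IsBarycentricModule R (fun r s : R => r + s) RewardSpace.pc where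
  barycentric := RewardSpace.barycentric
  zero_act := zero_add
  act_act r s x := (add_assoc r s x).symm
  act_comb := fun r p x y => RewardSpace.add_pc p r x y

theorem DW.act_single {X : Type*} (r s : R) (x : X) :
    DW.act r (StdSimplex.single (s, x)) = StdSimplex.single (r + s, x) :=
  StdSimplex.map_single _ _

theorem DW.act_mix {X : Type*} (r : R) (p : Prob) (μ ν : DW R X) :
    DW.act r (mix p μ ν) = mix p (DW.act r μ) (DW.act r ν) := map_mix _ _ _ _

theorem DW.isModule (X : Type*) : IsBarycentricModule R (A := DW R X) DW.act mix where
  barycentric := isBarycentric_mix _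
  zero_act μ := by
    simp only [DW.act, zero_add]
    exact StdSimplex.map_id μ
  act_act r s μ := by
    simp only [DW.act, StdSimplex.map_map, add_assoc]
  act_comb := DW.act_mix

omit [RewardSpace R] in
theorem DW.extend_single {X A : Type*} {act : R → A → A} {comb : Prob → A → A → A}
    (h : IsBarycentric comb) (f : X → A) (r : R) (x : X) :
    DW.extend act comb f (StdSimplex.single (r, x)) = act r (f x) :=
  convexSum_single h _ _

omit [RewardSpace R] in
theorem DW.extend_mix {X A : Type*} {act : R → A → A} {comb : Prob → A → A → A}
    (h : IsBarycentric comb) (f : X → A) (p : Prob) (μ ν : DW R X) :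
    DW.extend act comb f (mix p μ ν) =
      comb p (DW.extend act comb f μ) (DW.extend act comb f ν) :=
  convexSum_mix h _ _ _ _

theorem DW.extend_act {X A : Type*} {act : R → A → A} {comb : Prob → A → A → A}
    (h : IsBarycentricModule R act comb) (f : X → A) (r : R) (μ : DW R X) :
    DW.extend act comb f (DW.act r μ) = act r (DW.extend act comb f μ) := by
  induction μ using stdSimplex_induction with
  | single z =>
    obtain ⟨s, x⟩ := z
    rw [DW.act_single, DW.extend_single h.barycentric, DW.extend_single h.barycentric, h.act_act]
  | mix p μ ν hμ hν =>
    rw [DW.act_mix, DW.extend_mix h.barycentric, DW.extend_mix h.barycentric, hμ, hν, h.act_comb]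

theorem DW.expect_single {X : Type*} (r : R) (x : X) :
    DW.expect (StdSimplex.single (r, x)) = r :=
  convexSum_single RewardSpace.barycentric _ _

theorem DW.expect_mix {X : Type*} (p : Prob) (μ ν : DW R X) :
    DW.expect (mix p μ ν) = RewardSpace.pc p μ.expect ν.expect :=
  convexSum_mix RewardSpace.barycentric _ _ _ _

theorem DW.expect_act {X : Type*} (r : R) (μ : DW R X) : (DW.act r μ).expect = r + μ.expect := by
  induction μ using stdSimplex_induction with
  | single z =>
    obtain ⟨s, x⟩ := z
    rw [DW.act_single, DW.expect_single, DW.expect_single]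
  | mix p μ ν hμ hν =>
    rw [DW.act_mix, DW.expect_mix, DW.expect_mix, hμ, hν, RewardSpace.add_pc]

end Barycentric

/-! ### Algebraicity of the operations of the selection monad -/

section SelectionMonad

variable {R : Type u} [RewardSpace R] {T : Type u → Type u} [Monad T] [LawfulMonad T]
  {A : AuxData R T}

theorem AuxData.IsAuxiliary.rewardOf_pure (hA : A.IsAuxiliary) {X : Type u} (x : X) (γ : X → R) :
    A.rewardOf (pure x) γ = γ x := by
  rw [AuxData.rewardOf, map_pure, hA.alg_pure]

/-- This is the algebra law of `α` at the element of `T (T R)` obtained by mapping `γ` inside each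
`f x`. It says that a continuation can be summarized by the reward it yields. -/
theorem AuxData.IsAuxiliary.rewardOf_bind (hA : A.IsAuxiliary) {X Y : Type u} (t : T X)
    (f : X → T Y) (γ : Y → R) :
    A.rewardOf (t >>= f) γ = A.rewardOf t fun x => A.rewardOf (f x) γ := by
  have := hA.alg_join ((fun x => γ <$> f x) <$> t)
  simpa [AuxData.rewardOf, map_bind, bind_map_left] using this

theorem AuxData.reward_bind {X Y : Type u} (r : R) (x : T X) (f : X → T Y) :
    A.reward r x >>= f = A.reward r (x >>= f) := by
  simp [AuxData.reward]

theorem AuxData.prob_bind {X Y : Type u} (p : Prob) (x y : T X) (f : X → T Y) :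
    A.prob p x y >>= f = A.prob p (x >>= f) (y >>= f) := by
  simp only [AuxData.prob, bind_assoc]
  congr 1
  funext i
  split_ifs <;> rfl

theorem AuxData.IsAuxiliary.rewardOf_reward (hA : A.IsAuxiliary) {X : Type u} (r : R) (x : T X)
    (γ : X → R) : A.rewardOf (A.reward r x) γ = r + A.rewardOf x γ := by
  rw [AuxData.rewardOf, map_eq_pure_bind, AuxData.reward_bind, hA.alg_reward, ← map_eq_pure_bind,
    AuxData.rewardOf]

theorem AuxData.IsAuxiliary.rewardOf_prob (hA : A.IsAuxiliary) {X : Type u} (p : Prob)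
    (x y : T X) (γ : X → R) :
    A.rewardOf (A.prob p x y) γ = RewardSpace.pc p (A.rewardOf x γ) (A.rewardOf y γ) := by
  rw [AuxData.rewardOf, map_eq_pure_bind, AuxData.prob_bind, hA.alg_prob, ← map_eq_pure_bind,
    ← map_eq_pure_bind, AuxData.rewardOf, AuxData.rewardOf]

theorem AuxData.pure_selBind {X Y : Type u} (x : X)
    (f : X → Sel R T Y) : A.selBind (selPure x) f = f x := by
  funext γ
  simp [AuxData.selBind, selPure]

/-- By `rewardOf_bind`, `F` is given the same reward function under both bracketings. -/
theorem AuxData.IsAuxiliary.selBind_assoc (hA : A.IsAuxiliary) {X Y Z : Type u} (F : Sel R T X)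
    (f : X → Sel R T Y) (g : Y → Sel R T Z) :
    A.selBind (A.selBind F f) g = A.selBind F fun x => A.selBind (f x) g := by
  funext γ
  simp [AuxData.selBind, hA.rewardOf_bind]

/-- On the left, `F` and `G` are compared under the reward function pulled back along `f`; on the
right, the composites are compared under `γ`. By `rewardOf_bind` these are the same comparison. -/
theorem AuxData.IsAuxiliary.selOr_bind (hA : A.IsAuxiliary) {X Y : Type u} (F G : Sel R T X)
    (f : X → Sel R T Y) :
    A.selBind (A.selOr F G) f = A.selOr (A.selBind F f) (A.selBind G f) := by
  funext γ
  simp only [AuxData.selBind, AuxData.selOr, hA.rewardOf_bind]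
  split_ifs <;> rfl

theorem AuxData.selReward_bind {X Y : Type u} (r : R) (F : Sel R T X) (f : X → Sel R T Y) :
    A.selBind (A.selReward r F) f = A.selReward r (A.selBind F f) := by
  funext γ
  simp only [AuxData.selBind, AuxData.selReward, AuxData.reward_bind]

theorem AuxData.selProb_bind {X Y : Type u} (p : Prob) (F G : Sel R T X) (f : X → Sel R T Y) :
    A.selBind (A.selProb p F G) f = A.selProb p (A.selBind F f) (A.selBind G f) := by
  funext γ
  simp only [AuxData.selBind, AuxData.selProb, AuxData.prob_bind]

theorem AuxData.selSeq_pure {n : ℕ} {X : Fin n → Type u}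
    (x : ∀ i, X i) : A.selSeq (fun i => selPure (x i)) = selPure x := by
  induction n with
  | zero => exact congrArg selPure (funext fun i => i.elim0)
  | succ n ih =>
    rw [AuxData.selSeq, AuxData.pure_selBind, ih fun i => x i.succ, AuxData.pure_selBind]
    exact congrArg selPure (Fin.cons_self_tail x)

/-- When the components before `k` are pure, the sequence begins in effect with component `k`.
Everything after it forms a continuation independent of that component, which is the semantic
counterpart of the context `EvalCtx.fn`. -/
theorem AuxData.IsAuxiliary.selSeq_update (hA : A.IsAuxiliary) {n : ℕ} {X : Fin n → Type u}
    (F : ∀ i, Sel R T (X i)) (k : Fin n) (hF : ∀ i < k, ∃ x, F i = selPure x) :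
    ∃ K : X k → Sel R T (∀ i, X i), ∀ G, A.selSeq (Function.update F k G) = A.selBind G K := by
  induction n with
  | zero => exact k.elim0
  | succ n ih =>
    cases k using Fin.cases with
    | zero =>
      refine ⟨fun x => A.selBind (A.selSeq fun i => F i.succ) fun xs => selPure (Fin.cons x xs),
        fun G => ?_⟩
      rw [AuxData.selSeq, Function.update_self]
      rfl
    | succ k =>
      obtain ⟨x, hx⟩ := hF 0 (Fin.succ_pos k)
      obtain ⟨K, hK⟩ := ih (fun i => F i.succ) k fun i hi => hF _ (Fin.succ_lt_succ_iff.2 hi)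
      refine ⟨fun y => A.selBind (K y) fun xs => selPure (Fin.cons x xs), fun G => ?_⟩
      have htail : (fun i : Fin n => Function.update F k.succ G i.succ) =
          Function.update (fun i => F i.succ) k G := by
        funext i
        by_cases h : i = k
        · subst h; simp
        · rw [Function.update_of_ne h, Function.update_of_ne (by simpa using h)]
      rw [AuxData.selSeq, Function.update_of_ne (Fin.succ_ne_zero k).symm, hx, AuxData.pure_selBind,
        htail, hK, hA.selBind_assoc]

end SelectionMonad

/-! ### Denotations are preserved by evaluation -/

section Denotation

variable {V : Vocabulary.{v}} {ev : FnEval V} {R : Type u} [RewardSpace R]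
  (I : Interpretation V ev R) {T : Type u → Type u} [Monad T] (A : AuxData R T)

theorem Interpretation.den_rename {Γ Δ : List (Ty V.B)} {σ : Ty V.B} (M : Tm V Γ σ)
    (r : Ren V Γ Δ) (ρ : I.env T Δ) (ρ' : I.env T Γ)
    (h : ∀ τ x, I.lookup T (r τ x) ρ = I.lookup T x ρ') :
    I.den A (M.rename r) ρ = I.den A M ρ' := by
  induction M generalizing Δ with
  | lam M ih =>
    simp only [Tm.rename, Interpretation.den]
    congr 1
    funext x
    refine ih (r.lift _) (x, ρ) (x, ρ') fun τ y => ?_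
    cases y with
    | zero => rfl
    | succ y => exact h _ y
  | var x => simp only [Tm.rename, Interpretation.den, h]
  | con c => rfl
  | star => rfl
  | fn f M ih =>
    simp only [Tm.rename, Interpretation.den]
    congr 2
    funext i
    exact ih i r ρ ρ' h
  | ite L M N ih ih' ih'' =>
    simp only [Tm.rename, Interpretation.den, ih r ρ ρ' h, ih' r ρ ρ' h, ih'' r ρ ρ' h]
  | fst M ih => simp only [Tm.rename, Interpretation.den, ih r ρ ρ' h]
  | snd M ih => simp only [Tm.rename, Interpretation.den, ih r ρ ρ' h]
  | _ =>
    rename_i ih ih'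
    simp only [Tm.rename, Interpretation.den, ih r ρ ρ' h, ih' r ρ ρ' h]

/-- The call-by-value substitution lemma: the substituted terms must denote pure computations, since
the environment stores effect-free values. -/
theorem Interpretation.den_subst {Γ Δ : List (Ty V.B)} {σ : Ty V.B} (M : Tm V Γ σ)
    (s : Sub V Γ Δ) (ρ : I.env T Δ) (ρ' : I.env T Γ)
    (h : ∀ τ x, I.den A (s τ x) ρ = selPure (I.lookup T x ρ')) :
    I.den A (M.subst s) ρ = I.den A M ρ' := by
  induction M generalizing Δ with
  | lam M ih =>
    simp only [Tm.subst, Interpretation.den]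
    congr 1
    funext x
    refine ih (s.lift _) (x, ρ) (x, ρ') fun τ y => ?_
    cases y with
    | zero => rfl
    | succ y =>
      refine Eq.trans ?_ (h _ y)
      exact I.den_rename A (s _ y) (fun _ => Var.succ) _ ρ fun _ _ => rfl
  | var x => simp only [Tm.subst, Interpretation.den, h]
  | con c => rfl
  | star => rfl
  | fn f M ih =>
    simp only [Tm.subst, Interpretation.den]
    congr 2
    funext i
    exact ih i s ρ ρ' h
  | ite L M N ih ih' ih'' =>
    simp only [Tm.subst, Interpretation.den, ih s ρ ρ' h, ih' s ρ ρ' h, ih'' s ρ ρ' h]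
  | fst M ih => simp only [Tm.subst, Interpretation.den, ih s ρ ρ' h]
  | snd M ih => simp only [Tm.subst, Interpretation.den, ih s ρ ρ' h]
  | _ =>
    rename_i ih ih'
    simp only [Tm.subst, Interpretation.den, ih s ρ ρ' h, ih' s ρ ρ' h]

variable [LawfulMonad T] {A} (hA : A.IsAuxiliary)
include hA

theorem Interpretation.denP_toTm {σ : Ty V.B} (v : Val V σ) :
    I.denP A v.toTm = selPure (I.denVal A v) := by
  induction v with
  | con c => rfl
  | star => rfl
  | lam M => rfl
  | pair v w ihv ihw =>
    change A.selBind (I.denP A v.toTm) (fun x => A.selBind (I.denP A w.toTm) fun y =>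
      selPure (x, y)) = _
    rw [ihv, AuxData.pure_selBind, ihw, AuxData.pure_selBind]
    rfl

theorem Interpretation.denP_inst {σ τ : Ty V.B} (M : Tm V [σ] τ) (v : Val V σ) :
    I.denP A (M.inst v.toTm) = I.den A M (I.denVal A v, PUnit.unit) := by
  refine I.den_subst A M _ _ _ fun τ x => ?_
  cases x with
  | zero => exact I.denP_toTm hA v
  | succ x => cases x

omit [LawfulMonad T] hA in
variable (A) in
/-- The denotation of what a program does next. -/
def Interpretation.denRes {σ : Ty V.B} : Res V σ → Sel R T (I.ty T σ)
  | .val v => selPure (I.denVal A v)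
  | .step M => I.denP A M
  | .or M N => A.selOr (I.denP A M) (I.denP A N)
  | .reward c M => A.selReward (I.con c : R) (I.denP A M)
  | .prob p M N => A.selProb p (I.denP A M) (I.denP A N)

/-- If a frame `k` denotes Kleisli extension along `K`, it can be pulled through every operation,
because all of them are algebraic. The value case is asked only for values that `r` actually is, so
it is vacuous when `r` is known not to be one. -/
theorem Interpretation.denRes_bind {σ τ : Ty V.B} (r : Res V σ)
    (k : Program V σ → Program V τ) (kv : Val V σ → Res V τ) (K : I.ty T σ → Sel R T (I.ty T τ))
    (hk : ∀ P, I.denP A (k P) = A.selBind (I.denP A P) K)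
    (hkv : ∀ v, r = .val v → I.denRes A (kv v) = K (I.denVal A v)) :
    I.denRes A (r.bind k kv) = A.selBind (I.denRes A r) K := by
  cases r with
  | val v => exact (hkv v rfl).trans (AuxData.pure_selBind _ _).symm
  | step M => exact hk M
  | or M N =>
    simp only [Res.bind, Interpretation.denRes, hk, hA.selOr_bind]
  | reward c M => simp only [Res.bind, Interpretation.denRes, hk, AuxData.selReward_bind]
  | prob p M N => simp only [Res.bind, Interpretation.denRes, hk, AuxData.selProb_bind]

/-- Soundness of a single step, ordinary or algebraic: each evaluation frame denotes a Kleisli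
extension, so `denRes_bind` reduces the claim to the subterm being evaluated and to the redex. -/
theorem Interpretation.denP_next (hb : ∀ c : V.Con .bool, c = V.tt ∨ c = V.ff)
    {σ : Ty V.B} (M : Program V σ) : I.denP A M = I.denRes A (next ev M) := by
  induction M using Program.induction with
  | con c => rfl
  | star => rfl
  | lam M => rfl
  | or M N => rfl
  | prob p M N => rfl
  | fn f M ih =>
    change A.selBind (A.selSeq (X := fun i => baseSem R I.sem (f.dom i))
      fun i => I.denP A (M i)) (fun x => selPure (I.fn f x)) = _
    have hval : ∀ i, (next ev (M i)).IsVal → ∃ c, M i = .con c := fun i ⟨v, hv⟩ => by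
      have := next_sound ev hb (M i)
      rw [hv] at this
      exact ⟨v.toCon, by rw [← Val.toTm_con]; exact this⟩
    by_cases h : ∀ i, (next ev (M i)).IsVal
    · choose c hc using fun i => hval i (h i)
      obtain rfl : M = fun i => .con (c i) := funext hc
      rw [fnNext_con]
      change A.selBind (A.selSeq (X := fun i => baseSem R I.sem (f.dom i))
        fun i => selPure (I.con (c i))) (fun x => selPure (I.fn f x)) =
        selPure (I.con (ev.val f c))
      rw [AuxData.selSeq_pure (X := fun i => baseSem R I.sem (f.dom i)) fun i => I.con (c i),
        AuxData.pure_selBind, I.fn_con]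
    · push Not at h
      obtain ⟨k, hk, hmin⟩ := WellFounded.has_min wellFounded_lt
        {i | ¬ (next ev (M i)).IsVal} h
      have hmin : ∀ i < k, (next ev (M i)).IsVal := fun i hi => by
        by_contra hc; exact hmin i hc hi
      obtain ⟨K, hK⟩ := hA.selSeq_update (X := fun i => baseSem R I.sem (f.dom i))
        (fun i => I.denP A (M i)) k fun i hi => by
          obtain ⟨c, hc⟩ := hval i (hmin i hi)
          exact ⟨I.con c, by rw [hc]; rfl⟩
      have hfn : ∀ P, I.denP A (.fn f (Function.update M k P)) = A.selBind (I.denP A P)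
          fun x => A.selBind (K x) fun x => selPure (X := I.ty T (.base f.cod)) (I.fn f x) := by
        intro P
        have hupd : (fun i => I.denP A (Function.update M k P i)) =
            Function.update (fun i => I.denP A (M i)) k (I.denP A P) :=
          funext fun i => Function.apply_update (fun _ => I.denP A) M k P i
        exact (congrArg (fun F => A.selBind F fun x => selPure (I.fn f x))
          ((congrArg A.selSeq hupd).trans (hK _))).trans (hA.selBind_assoc _ _ _)
      have hM := hfn (M k)
      rw [Function.update_eq_self, ih k] at hM
      refine hM.trans ?_
      rw [← I.denRes_bind hA (σ := .base (f.dom k)) (τ := .base f.cod) _ _ _ _ hfn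
        fun v hv => absurd ⟨v, hv⟩ hk,
        ← fnNext_of_not_isVal ev f M (fun i => next ev (M i)) k hk hmin
          (fun _ => .step (.fn f M))]
      rfl
  | ite L M N ih =>
    change A.selBind (I.denP A L) _ = _
    rw [ih]
    refine (I.denRes_bind hA _ _ _ _ (fun _ => rfl) fun v hv => ?_).symm
    cases v with | con c =>
    change I.denP A (@ite _ (c = V.tt) (Classical.dec _) M N) = _
    by_cases h : c = V.tt
    · have hd : (I.con c : ULift Bool).down = true := by rw [h, I.con_tt]
      exact (congrArg (I.denP A) (if_pos h)).trans (if_pos hd).symm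
    · have hd : ¬ (I.con c : ULift Bool).down = true := by
        rw [(hb c).resolve_left h, I.con_ff]; simp
      exact (congrArg (I.denP A) (if_neg h)).trans (if_neg hd).symm
  | reward N M ih =>
    change A.selBind (I.denP A N) _ = _
    rw [ih]
    refine (I.denRes_bind hA _ _ _ _ (fun _ => rfl) fun v hv => ?_).symm
    cases v with | con c => rfl
  | @pair σ τ M N ih ih' =>
    change A.selBind (I.denP A M) _ = _
    rw [ih]
    refine (I.denRes_bind hA _ _ _ _ (fun _ => rfl) fun v hv => ?_).symm
    refine (I.denRes_bind hA _ _ _ 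
      (fun y => selPure (X := I.ty T (.prod σ τ)) (I.denVal A v, y)) (fun P => ?_)
      fun w hw => rfl).trans (congrArg (fun F => A.selBind F _) ih'.symm)
    change A.selBind (I.denP A v.toTm) _ = _
    rw [I.denP_toTm hA, AuxData.pure_selBind]
    rfl
  | fst M ih =>
    change A.selBind (I.denP A M) _ = _
    rw [ih]
    refine (I.denRes_bind hA _ _ _ _ (fun _ => rfl) fun v hv => ?_).symm
    cases v with | pair v w => exact I.denP_toTm hA v
  | snd M ih =>
    change A.selBind (I.denP A M) _ = _
    rw [ih]
    refine (I.denRes_bind hA _ _ _ _ (fun _ => rfl) fun v hv => ?_).symm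
    cases v with | pair v w => exact I.denP_toTm hA w
  | app M N ih ih' =>
    change A.selBind (I.denP A M) _ = _
    rw [ih]
    refine (I.denRes_bind hA _ _ _ _ (fun _ => rfl) fun v hv => ?_).symm
    cases v with | lam L =>
    change I.denRes A ((next ev N).bind (fun N => .app (.lam L) N)
      fun w => .step (L.inst w.toTm)) = _
    refine (I.denRes_bind hA _ _ (fun w => .step (L.inst w.toTm)) (fun y => I.den A L (y, PUnit.unit)) (fun P => ?_)
      fun w hw => I.denP_inst hA L w).trans (congrArg (fun F => A.selBind F _) ih'.symm)
    change A.selBind (I.denP A (.lam L)) _ = _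
    exact AuxData.pure_selBind _ _

omit [LawfulMonad T] hA in
variable (A) in
/-- The denotation of an effect value. -/
def Interpretation.denEff {σ : Ty V.B} : EffVal V σ → Sel R T (I.ty T σ)
  | .val v => selPure (I.denVal A v)
  | .or E₁ E₂ => A.selOr (denEff E₁) (denEff E₂)
  | .reward c E => A.selReward (I.con c : R) (denEff E)
  | .prob p E₁ E₂ => A.selProb p (denEff E₁) (denEff E₂)

theorem Interpretation.denP_eq_denEff (hb : ∀ c : V.Con .bool, c = V.tt ∨ c = V.ff)
    {σ : Ty V.B} {M : Program V σ} {E : EffVal V σ} (h : Runs ev M E) :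
    I.denP A M = I.denEff A E := by
  induction h with
  | val h => rw [I.denP_next hA hb, h]; rfl
  | step h _ ih => rw [I.denP_next hA hb, h]; exact ih
  | or h _ _ ih₁ ih₂ =>
    rw [I.denP_next hA hb, h, Interpretation.denEff, ← ih₁, ← ih₂]; rfl
  | reward h _ ih => rw [I.denP_next hA hb, h, Interpretation.denEff, ← ih]; rfl
  | prob h _ _ ih₁ ih₂ =>
    rw [I.denP_next hA hb, h, Interpretation.denEff, ← ih₁, ← ih₂]; rfl

end Denotation

/-! ### Least maximizers on lexicographic sums and products -/

section Argmax

variable {S S₁ S₂ : Type*} {R : Type u} [LinearOrder R]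

theorem le_argmax [LinearOrder S] [Fintype S] [Nonempty S] (γ : S → R) (s : S) :
    γ s ≤ γ (argmax γ) := by
  have := Finset.min'_mem (Finset.univ.filter fun s => ∀ s', γ s' ≤ γ s) (by
    obtain ⟨s, hs⟩ := Finite.exists_max γ
    exact ⟨s, by simpa using hs⟩)
  exact (Finset.mem_filter.1 this).2 s

theorem argmax_le [LinearOrder S] [Fintype S] [Nonempty S] (γ : S → R) (s : S)
    (h : ∀ s', γ s' ≤ γ s) : argmax γ ≤ s :=
  Finset.min'_le _ _ (by simpa using h)

variable [LinearOrder S₁] [Fintype S₁] [Nonempty S₁] [LinearOrder S₂] [Fintype S₂] [Nonempty S₂]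

/-- In the lexicographic sum every left element precedes every right one, so a tie goes left. This
matches the non-strict comparison in `selOr`. -/
theorem argmax_sum [Fintype (S₁ ⊕ₗ S₂)] [Nonempty (S₁ ⊕ₗ S₂)] (γ : S₁ ⊕ₗ S₂ → R) :
    argmax γ = if γ (toLex (.inr (argmax fun s => γ (toLex (.inr s))))) ≤
        γ (toLex (.inl (argmax fun s => γ (toLex (.inl s)))))
      then toLex (.inl (argmax fun s => γ (toLex (.inl s))))
      else toLex (.inr (argmax fun s => γ (toLex (.inr s)))) := by
  have h₁ := le_argmax fun s => γ (toLex (.inl s))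
  have h₂ := le_argmax fun s => γ (toLex (.inr s))
  have h := le_argmax γ
  split_ifs with hle
  · refine le_antisymm (argmax_le _ _ fun s => ?_) ?_
    · rcases s with s | s
      exacts [h₁ s, (h₂ s).trans hle]
    · rcases hs : argmax γ with s | s
      · rw [hs] at h
        exact Sum.Lex.inl_le_inl_iff.2 (argmax_le _ _ fun s' => h _)
      · exact Sum.Lex.inl_le_inr _ _
  · rw [not_le] at hle
    refine le_antisymm (argmax_le _ _ fun s => ?_) ?_
    · rcases s with s | s
      exacts [(h₁ s).trans hle.le, h₂ s]
    · rcases hs : argmax γ with s | s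
      · rw [hs] at h
        exact absurd (hle.trans_le (h _)) (not_lt.2 (h₁ s))
      · rw [hs] at h
        exact Sum.Lex.inr_le_inr_iff.2 (argmax_le _ _ fun s' => h _)

/-- Reflection of the order in the first argument already forces the first component of a maximizing
pair to be maximal; the lexicographic order then makes it the least such one. -/
theorem argmax_prod_fst [Fintype (S₁ ×ₗ S₂)] [Nonempty (S₁ ×ₗ S₂)] (γ₁ : S₁ → R) (γ₂ : S₂ → R)
    (f : R → R → R) (hf : ∀ a b c, f a c ≤ f b c → a ≤ b) :
    (ofLex (argmax fun s : S₁ ×ₗ S₂ => f (γ₁ (ofLex s).1) (γ₂ (ofLex s).2))).1 = argmax γ₁ := by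
  set γ : S₁ ×ₗ S₂ → R := fun s => f (γ₁ (ofLex s).1) (γ₂ (ofLex s).2)
  have h : ∀ s, γ₁ s ≤ γ₁ (ofLex (argmax γ)).1 := fun s =>
    hf _ _ _ (le_argmax γ (toLex (s, (ofLex (argmax γ)).2)))
  refine le_antisymm ?_ (argmax_le _ _ h)
  have heq : γ₁ (argmax γ₁) = γ₁ (ofLex (argmax γ)).1 := le_antisymm (h _) (le_argmax _ _)
  -- Exchanging the first component for the least maximizer leaves the value unchanged, so the new
  -- pair still competes and cannot be below the least maximizing pair.
  have := argmax_le γ (toLex (argmax γ₁, (ofLex (argmax γ)).2)) fun s' =>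
    (le_argmax γ s').trans_eq (by simp [γ, heq])
  exact Prod.Lex.monotone_fst _ _ this

theorem argmax_prod_snd [Fintype (S₁ ×ₗ S₂)] [Nonempty (S₁ ×ₗ S₂)] (γ₁ : S₁ → R) (γ₂ : S₂ → R)
    (f : R → R → R) (hf : ∀ a b c, f c a ≤ f c b → a ≤ b) :
    (ofLex (argmax fun s : S₁ ×ₗ S₂ => f (γ₁ (ofLex s).1) (γ₂ (ofLex s).2))).2 = argmax γ₂ := by
  set γ : S₁ ×ₗ S₂ → R := fun s => f (γ₁ (ofLex s).1) (γ₂ (ofLex s).2)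
  have h : ∀ s, γ₂ s ≤ γ₂ (ofLex (argmax γ)).2 := fun s =>
    hf _ _ _ (le_argmax γ (toLex ((ofLex (argmax γ)).1, s)))
  refine le_antisymm ?_ (argmax_le _ _ h)
  have heq : γ₂ (argmax γ₂) = γ₂ (ofLex (argmax γ)).2 := le_antisymm (h _) (le_argmax _ _)
  -- The competing pair has the same first component, so the lexicographic comparison falls to the
  -- second.
  have := argmax_le γ (toLex ((ofLex (argmax γ)).1, argmax γ₂)) fun s' =>
    (le_argmax γ s').trans_eq (by simp [γ, heq])
  rcases Prod.Lex.le_iff.1 this with h | h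
  · exact absurd h (lt_irrefl _)
  · exact h.2

end Argmax

/-! ### Compositionality of optimal strategies, and adequacy at zero reward -/

section Adequacy

open Convexity

variable {V : Vocabulary.{v}} {ev : FnEval V} {R : Type u} [RewardSpace R]
  (I : Interpretation V ev R)

theorem Interpretation.opS_or {σ : Ty V.B} (E₁ E₂ : EffVal V σ) :
    I.opS (.or E₁ E₂) =
      if (I.opS E₂).expect ≤ (I.opS E₁).expect then I.opS E₁ else I.opS E₂ := by
  have := argmax_sum (S₁ := Str E₁) (S₂ := Str E₂)
    fun s : Str (.or E₁ E₂) => (I.out (.or E₁ E₂) s).expect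
  exact (congrArg (I.out (.or E₁ E₂)) this).trans (apply_ite (I.out (.or E₁ E₂)) _ _ _)

theorem RewardSpace.add_left_le_iff {r s t : R} : t + r ≤ t + s ↔ r ≤ s := by
  rw [add_comm t, add_comm t, ← RewardSpace.le_iff_add_le]

theorem argmax_congr {S : Type*} [LinearOrder S] [Fintype S] [Nonempty S] {γ γ' : S → R}
    (h : ∀ s s', γ s ≤ γ s' ↔ γ' s ≤ γ' s') : argmax γ = argmax γ' := by
  unfold argmax
  simp only [h]

theorem Interpretation.opS_reward {σ : Ty V.B} (c : V.Con .rew) (E : EffVal V σ) :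
    I.opS (.reward c E) = DW.act (I.con c : R) (I.opS E) := by
  refine congrArg (fun s : Str E => DW.act (I.con c : R) (I.out E s))
    (argmax_congr (γ := fun s : Str E => (DW.act (I.con c : R) (I.out E s)).expect) ?_)
  intro s s'
  simp only [DW.expect_act]
  exact RewardSpace.add_left_le_iff

theorem RewardSpace.pc_le_pc_left {p : Prob} (hp : 0 < p) (r s t : R)
    (h : RewardSpace.pc p r t ≤ RewardSpace.pc p s t) : r ≤ s := by
  rcases eq_or_ne p 1 with rfl | hp'
  · simpa [RewardSpace.barycentric.comb_one] using h
  · exact (RewardSpace.le_iff_pc_le p r s t hp (lt_of_le_of_ne p.2.2 hp')).2 h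

theorem RewardSpace.pc_le_pc_right {p : Prob} (hp : p < 1) (r s t : R)
    (h : RewardSpace.pc p t r ≤ RewardSpace.pc p t s) : r ≤ s := by
  rw [RewardSpace.barycentric.comb_symm, RewardSpace.barycentric.comb_symm p t] at h
  refine RewardSpace.pc_le_pc_left ?_ r s t h
  rw [← unitInterval.symm_one, unitInterval.symm_lt_symm]
  exact hp

/-- A choice of strategies for the two branches is optimal when each is optimal, since mixing
reflects the order in each argument of positive weight. -/
theorem Interpretation.opS_prob {σ : Ty V.B} (p : Prob) (E₁ E₂ : EffVal V σ) :
    I.opS (.prob p E₁ E₂) = mix p (I.opS E₁) (I.opS E₂) := by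
  -- At `p = 0` or `p = 1` the component in the branch of weight zero need not be the optimum of
  -- that branch, since it does not affect the expected reward. It does not affect the mixture
  -- either, so optimality is recorded only for a branch of positive weight.
  have key : ∃ t : Str E₁ ×ₗ Str E₂,
      I.opS (.prob p E₁ E₂) = mix p (I.out E₁ (ofLex t).1) (I.out E₂ (ofLex t).2) ∧
      (0 < p → (ofLex t).1 = argmax fun s => (I.out E₁ s).expect) ∧
      (p < 1 → (ofLex t).2 = argmax fun s => (I.out E₂ s).expect) := by
    have hγ : (fun s : Str (.prob p E₁ E₂) => (I.out (.prob p E₁ E₂) s).expect) =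
        fun s : Str E₁ ×ₗ Str E₂ => RewardSpace.pc p (I.out E₁ (ofLex s).1).expect
          (I.out E₂ (ofLex s).2).expect := funext fun s => DW.expect_mix p _ _
    refine ⟨_, rfl, fun hp => ?_, fun hp => ?_⟩
    · rw [hγ]
      exact argmax_prod_fst (fun s => (I.out E₁ s).expect) (fun s => (I.out E₂ s).expect)
        (RewardSpace.pc p) (RewardSpace.pc_le_pc_left hp)
    · rw [hγ]
      exact argmax_prod_snd (fun s => (I.out E₁ s).expect) (fun s => (I.out E₂ s).expect)
        (RewardSpace.pc p) (RewardSpace.pc_le_pc_right hp)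
  obtain ⟨t, h, h₁, h₂⟩ := key
  rw [h]
  rcases eq_or_ne p 0 with rfl | hp
  · rw [(isBarycentric_mix _).comb_zero, (isBarycentric_mix _).comb_zero, h₂ zero_lt_one]
    rfl
  rw [h₁ (lt_of_le_of_ne p.2.1 hp.symm)]
  rcases eq_or_ne p 1 with rfl | hp'
  · rw [mix_one, mix_one]
    rfl
  rw [h₂ (lt_of_le_of_ne p.2.2 hp')]
  rfl

theorem Interpretation.opS_val {σ : Ty V.B} (v : Val V σ) :
    I.opS (.val v) = StdSimplex.single ((0 : R), v) := rfl

variable {T : Type u → Type u} [Monad T] [LawfulMonad T] {A : AuxData R T}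

theorem Interpretation.denDW_single (hA : A.IsAuxiliary) {σ : Ty V.B} (r : R) (v : Val V σ) :
    I.denDW A (StdSimplex.single (r, v)) = A.reward r (pure (I.denVal A v)) :=
  DW.extend_single (hA.isModule _).barycentric _ _ _

theorem Interpretation.denDW_mix (hA : A.IsAuxiliary) {σ : Ty V.B} (p : Prob)
    (μ ν : DW R (Val V σ)) : I.denDW A (mix p μ ν) = A.prob p (I.denDW A μ) (I.denDW A ν) :=
  DW.extend_mix (hA.isModule _).barycentric _ _ _ _

/-- With the zero reward function the final values contribute nothing, so `α` collects only the
accumulated rewards. This identifies the comparison made by `selOr` with the one made by strategies.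
-/
theorem Interpretation.rewardOf_denDW (hA : A.IsAuxiliary) {σ : Ty V.B} (μ : DW R (Val V σ)) :
    A.rewardOf (I.denDW A μ) (fun _ => 0) = μ.expect := by
  induction μ using stdSimplex_induction with
  | single z =>
    rw [I.denDW_single hA, hA.rewardOf_reward, hA.rewardOf_pure, add_zero]
    exact (DW.expect_single _ _).symm
  | mix p μ ν hμ hν => rw [I.denDW_mix hA, hA.rewardOf_prob, hμ, hν, DW.expect_mix]

/-- The reward function remains zero throughout the tree, because the operations act pointwise in
it. The recursion defining `denEff` thus becomes the recursion satisfied by `opS`, transported along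
the homomorphism `denDW`. -/
theorem Interpretation.denEff_zero (hA : A.IsAuxiliary) {σ : Ty V.B} (E : EffVal V σ) :
    I.denEff A E (fun _ => 0) = I.denDW A (I.opS E) := by
  induction E with
  | val v =>
    rw [I.opS_val, I.denDW_single hA, (hA.isModule _).zero_act]
    rfl
  | or E₁ E₂ ih₁ ih₂ =>
    simp only [Interpretation.denEff, AuxData.selOr, ih₁, ih₂, I.rewardOf_denDW hA, I.opS_or,
      ge_iff_le]
    split_ifs <;> rfl
  | reward c E ih =>
    simp only [Interpretation.denEff, AuxData.selReward, ih, I.opS_reward]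
    exact (DW.extend_act (hA.isModule _) _ _ _).symm
  | prob p E₁ E₂ ih₁ ih₂ =>
    simp only [Interpretation.denEff, AuxData.selProb, ih₁, ih₂, I.opS_prob, I.denDW_mix hA]

include I

/-- Constants of type `Bool` embed in a two-element set whose elements are already denoted by `tt`
and `ff`. -/
theorem Interpretation.eq_tt_or_ff (c : V.Con .bool) : c = V.tt ∨ c = V.ff := by
  rcases h : I.con c with ⟨_ | _⟩
  · exact .inr (I.con_injective _ (h.trans I.con_ff.symm))
  · exact .inl (I.con_injective _ (h.trans I.con_tt.symm))

theorem Interpretation.tt_ne_ff : V.tt ≠ V.ff := by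
  intro h
  have := I.con_tt.symm.trans ((congrArg I.con h).trans I.con_ff)
  simp at this

end Adequacy

/-! ### The three auxiliary monads -/

section FreeModules

open Convexity

variable {R : Type u} [RewardSpace R]

/-- `T` is the free-algebra monad of a class of barycentric modules that contains `R`, with the
evident generic effects. -/
structure AuxData.IsFree {T : Type u → Type u} [Monad T] (A : AuxData R T)
    (act : ∀ {X : Type u}, R → T X → T X) (comb : ∀ {X : Type u}, Prob → T X → T X → T X) :
    Prop where
  isModule : ∀ X, IsBarycentricModule R (A := T X) act comb
  pure_bind : ∀ {X Y : Type u} (x : X) (f : X → T Y), pure x >>= f = f x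
  act_bind : ∀ {X Y : Type u} (r : R) (a : T X) (f : X → T Y), act r a >>= f = act r (a >>= f)
  comb_bind : ∀ {X Y : Type u} (p : Prob) (a b : T X) (f : X → T Y),
    comb p a b >>= f = comb p (a >>= f) (b >>= f)
  induction : ∀ {X : Type u} {P : T X → Prop} (_of_pure : ∀ x, P (pure x))
    (_of_act : ∀ r a, P a → P (act r a)) (_of_comb : ∀ p a b, P a → P b → P (comb p a b)) (a), P a
  genReward_eq : ∀ r, A.genReward r = act r (pure PUnit.unit)
  genProb_eq : ∀ p, A.genProb p = comb p (pure (ULift.up 0)) (pure (ULift.up 1))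
  alg_pure : ∀ r, A.alg (pure r) = r
  alg_act : ∀ r x, A.alg (act r x) = r + A.alg x
  alg_comb : ∀ p x y, A.alg (comb p x y) = RewardSpace.pc p (A.alg x) (A.alg y)

namespace AuxData.IsFree

variable {T : Type u → Type u} [Monad T] {A : AuxData R T}
  {act : ∀ {X : Type u}, R → T X → T X} {comb : ∀ {X : Type u}, Prob → T X → T X → T X}

theorem bind_pure (h : A.IsFree act comb) {X : Type u} (a : T X) : a >>= pure = a := by
  induction a using h.induction with
  | _of_pure x => exact h.pure_bind _ _
  | _of_act r a ih => rw [h.act_bind, ih]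
  | _of_comb p a b iha ihb => rw [h.comb_bind, iha, ihb]

theorem bind_assoc (h : A.IsFree act comb) {X Y Z : Type u} (a : T X) (f : X → T Y)
    (g : Y → T Z) : a >>= f >>= g = a >>= fun x => f x >>= g := by
  induction a using h.induction with
  | _of_pure x => rw [h.pure_bind, h.pure_bind]
  | _of_act r a ih => rw [h.act_bind, h.act_bind, h.act_bind, ih]
  | _of_comb p a b iha ihb => rw [h.comb_bind, h.comb_bind, h.comb_bind, iha, ihb]

theorem reward_eq (h : A.IsFree act comb) {X : Type u} (r : R) (x : T X) :
    A.reward r x = act r x := by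
  rw [AuxData.reward, h.genReward_eq, h.act_bind, h.pure_bind]

theorem prob_eq (h : A.IsFree act comb) {X : Type u} (p : Prob) (x y : T X) :
    A.prob p x y = comb p x y := by
  rw [AuxData.prob, h.genProb_eq, h.comb_bind, h.pure_bind, h.pure_bind]
  simp

/-- Both sides of the algebra law are homomorphisms in `t` that agree on units, and units generate.
The operations derived from the generic effects are the given `act` and `comb`. -/
theorem isAuxiliary [LawfulMonad T] (h : A.IsFree act comb) : A.IsAuxiliary where
  alg_pure := h.alg_pure
  alg_join t := by
    simp only [map_eq_pure_bind]
    induction t using h.induction with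
    | _of_pure x => rw [h.pure_bind, h.pure_bind, h.alg_pure, id]
    | _of_act r a ih => rw [h.act_bind, h.act_bind, h.alg_act, h.alg_act, ih]
    | _of_comb p a b iha ihb => rw [h.comb_bind, h.comb_bind, h.alg_comb, h.alg_comb, iha, ihb]
  isModule X := by
    simp only [h.reward_eq, h.prob_eq]
    exact h.isModule X
  alg_reward r x := by rw [h.reward_eq, h.alg_act]
  alg_prob p x y := by rw [h.prob_eq, h.alg_comb]

end AuxData.IsFree

/-! ### The distribution-writer monad -/

theorem T1.isFree : (T1.aux R).IsFree (fun {X} r (a : DW R X) => (DW.act r a : DW R X))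
    (fun {X} p (a b : DW R X) => (mix p a b : DW R X)) where
  isModule X := DW.isModule X
  pure_bind x f := (DW.extend_single (isBarycentric_mix _) f 0 x).trans ((DW.isModule _).zero_act _)
  act_bind r a f := DW.extend_act (DW.isModule _) f r a
  comb_bind p a b f := DW.extend_mix (isBarycentric_mix _) f p a b
  induction {X P} hpure hact hcomb a := by
    refine stdSimplex_induction (P := P) (fun z => ?_) hcomb a
    have := hact z.1 _ (hpure z.2)
    change P (DW.act z.1 (StdSimplex.single (0, z.2))) at this
    rwa [DW.act_single, add_zero] at this
  genReward_eq r := by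
    change _ = DW.act r (StdSimplex.single (0, PUnit.unit))
    rw [DW.act_single, add_zero]
    rfl
  genProb_eq p := rfl
  alg_pure r := (DW.extend_single RewardSpace.barycentric id 0 r).trans (zero_add r)
  alg_act r x := DW.extend_act RewardSpace.isModule id r x
  alg_comb p x y := DW.extend_mix RewardSpace.barycentric id p x y

theorem T1.lawfulMonad : LawfulMonad (T1 R) :=
  .mk' _ (fun a => T1.isFree.bind_pure a) (fun x f => T1.isFree.pure_bind x f)
    (fun a f g => T1.isFree.bind_assoc a f g)

/-! ### Distributions with rewards on the support -/

namespace T2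

/-- The function sending `x` to the multiple of the reward of `x` by `w` times its probability. -/
noncomputable def toCone {X : Type u} (w : ℝ) (a : T2 R X) :
    X → BaryCone (RewardSpace.barycentric (R := R)) :=
  fun x => BaryCone.mk _ (w * a.dist.weights x) (a.rew x)

/-- The cone forgets the point of a multiple of weight zero, so truncating `ρ` outside the support
has no effect. -/
theorem toCone_ofFun {X : Type u} (w : ℝ) (μ : StdSimplex ℝ X) (ρ : X → R) :
    toCone w (ofFun μ ρ) = fun x => BaryCone.mk _ (w * μ.weights x) (ρ x) := by
  funext x
  by_cases h : μ.weights x = 0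
  · simp [toCone, ofFun, h, BaryCone.mk_zero]
  · simp [toCone, ofFun, h]

/-- The weight chosen in `T2.comb` is what makes mixing a pointwise addition of rewards weighted by
their probabilities. Where the mixture vanishes that weight is a division by zero, but all multiples
there are zero. -/
theorem isConeMap_toCone (X : Type u) : IsConeMap (A := T2 R X) comb toCone where
  zero a := by
    funext x
    simp [toCone, BaryCone.mk_zero]
  add v w a hv hw := by
    funext x
    have hx := a.dist.nonneg x
    simp only [toCone, add_mul, Pi.add_apply]
    exact (BaryCone.isConeMap _).add _ _ _ (mul_nonneg hv hx) (mul_nonneg hw hx)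
  comb w p a b hw := by
    rw [comb, toCone_ofFun]
    funext x
    have ha : 0 ≤ a.dist.weights x := a.dist.nonneg x
    have hb : 0 ≤ b.dist.weights x := b.dist.nonneg x
    have hp : (0 : ℝ) ≤ p := p.2.1
    have hp' : (0 : ℝ) ≤ 1 - p := sub_nonneg.2 p.2.2
    have hpa := mul_nonneg hp ha
    have hpb := mul_nonneg hp' hb
    have hmix : (mix p a.dist b.dist).weights x =
        p * a.dist.weights x + (1 - p) * b.dist.weights x := by
      rw [weights_mix]; rfl
    have hν : 0 ≤ (mix p a.dist b.dist).weights x := (mix p a.dist b.dist).nonneg x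
    simp only [toCone, Pi.add_apply]
    rw [(BaryCone.isConeMap _).comb _ _ _ _ (mul_nonneg hw hν)]
    rcases hν.eq_or_lt with h0 | hpos
    · rw [← h0]
      rw [hmix] at h0
      have h1 : (p : ℝ) * a.dist.weights x = 0 := by linarith
      have h2 : (1 - p : ℝ) * b.dist.weights x = 0 := by linarith
      simp only [mul_assoc, h1, h2, mul_zero, zero_mul, BaryCone.mk_zero]
    · rw [Set.projIcc_of_mem _ ⟨div_nonneg hpa hν, (div_le_one hpos).2 (by linarith)⟩]
      congr 2
      · simp only
        field_simp
      · simp only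
        field_simp
        rw [hmix]
        ring

/-- A multiple of positive weight remembers both weight and point. At weight zero the reward is
recovered from the convention that it vanishes off the support. -/
theorem toCone_injective (X : Type u) : Function.Injective (toCone (R := R) (X := X) 1) := by
  intro a b hab
  have key : ∀ x, a.dist.weights x = b.dist.weights x ∧ a.rew x = b.rew x := by
    intro x
    have h := congrFun hab x
    simp only [toCone, one_mul] at h
    rcases (show 0 ≤ a.dist.weights x from a.dist.nonneg x).eq_or_lt with ha | ha <;>
      rcases (show 0 ≤ b.dist.weights x from b.dist.nonneg x).eq_or_lt with hb | hb
    · exact ⟨ha.symm.trans hb, (a.rew_eq_zero x ha.symm).trans (b.rew_eq_zero x hb.symm).symm⟩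
    · rw [← ha, BaryCone.mk_zero, BaryCone.mk_of_pos hb] at h
      cases h
    · rw [← hb, BaryCone.mk_zero, BaryCone.mk_of_pos ha] at h
      cases h
    · rw [BaryCone.mk_of_pos ha, BaryCone.mk_of_pos hb] at h
      have h := Option.some.inj h
      exact ⟨congrArg (fun z => (z.1 : ℝ)) h, congrArg Prod.snd h⟩
  refine T2.ext ?_ (funext fun x => (key x).2)
  ext x
  exact (key x).1

theorem toCone_act {X : Type u} (w : ℝ) (r : R) (a : T2 R X) :
    toCone w (act r a) = fun x => BaryCone.mk _ (w * a.dist.weights x) (r + a.rew x) :=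
  toCone_ofFun _ _ _

theorem ofFun_rew {X : Type u} (a : T2 R X) : ofFun a.dist a.rew = a :=
  toCone_injective X (toCone_ofFun _ _ _)

theorem isModule (X : Type u) : IsBarycentricModule R (A := T2 R X) act comb where
  barycentric := (isConeMap_toCone X).isBarycentric (toCone_injective X)
  zero_act a := toCone_injective X (by
    rw [toCone_act]
    simp only [zero_add]
    rfl)
  act_act r s a := toCone_injective X (by
    rw [toCone_act, toCone_act]
    funext x
    by_cases h : a.dist.weights x = 0
    · simp [act, ofFun, h, BaryCone.mk_zero]
    · simp [act, ofFun, h, add_assoc])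
  act_comb r p a b := toCone_injective X (by
    -- Adding `r` is an affine map of `R`, so it induces an additive map of cones; distributivity
    -- over mixtures is the additivity of that map at each point.
    let ψ : ℝ → R → BaryCone (RewardSpace.barycentric (R := R)) :=
      fun w s => BaryCone.mk _ w (r + s)
    have hψ : IsConeMap RewardSpace.pc ψ :=
      (BaryCone.isConeMap RewardSpace.barycentric).comp (h := fun s : R => r + s)
        fun p s s' => RewardSpace.add_pc p r s s'
    have hact : ∀ (w : ℝ) (_ : 0 ≤ w) (a : T2 R X),
        toCone w (act r a) = fun x => BaryCone.lift _ hψ (toCone w a x) := by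
      intro w hw a
      rw [toCone_act]
      funext x
      exact (BaryCone.lift_mk _ hψ (mul_nonneg hw (a.dist.nonneg x)) _).symm
    have hp : (0 : ℝ) ≤ 1 * p := by simpa using p.2.1
    have hp' : (0 : ℝ) ≤ 1 * (1 - p) := by simpa using p.2.2
    rw [(isConeMap_toCone X).comb _ _ _ _ zero_le_one, hact _ zero_le_one, hact _ hp,
      hact _ hp', (isConeMap_toCone X).comb _ _ _ _ zero_le_one]
    funext x
    exact map_add _ _ _)

/-- The action of `R` on `T₂(X)` is affine in `R`. -/
theorem pc_act {X : Type u} (p : Prob) (r s : R) (a : T2 R X) :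
    act (RewardSpace.pc p r s) a = comb p (act r a) (act s a) := by
  apply toCone_injective X
  rw [(isConeMap_toCone X).comb _ _ _ _ zero_le_one, toCone_act, toCone_act, toCone_act]
  funext x
  have hx : 0 ≤ a.dist.weights x := a.dist.nonneg x
  simp only [Pi.add_apply, one_mul]
  rw [add_comm, RewardSpace.add_pc, (BaryCone.isConeMap _).comb _ _ _ _ hx,
    add_comm r, add_comm s, mul_comm _ (p : ℝ), mul_comm _ (1 - p : ℝ)]

section Extend

variable {X : Type u} {A : Type*} {act' : R → A → A} {comb' : Prob → A → A → A}
  (h : IsBarycentricModule R act' comb') (f : X → A)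

include h

theorem extend_unit (x : X) : extend act' comb' f (unit R x) = f x := by
  rw [extend]
  change convexSum comb' (StdSimplex.single x) _ = _
  rw [convexSum_single h.barycentric]
  simp [unit, ofFun, h.zero_act]

theorem extend_act (r : R) (a : T2 R X) :
    extend act' comb' f (act r a) = act' r (extend act' comb' f a) := by
  rw [extend, extend, map_convexSum (fun p x y => h.act_comb r p x y)]
  refine convexSum_congr _ fun x hx => ?_
  have hx : a.dist.weights x ≠ 0 := hx
  simp [act, ofFun, hx, h.act_act]

/-- The hypothesis `hpc` makes `r ↦ act' r (f x)` affine for each `x`, so it induces an additive map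
from the cone of `R` to the cone of `A`. Extension is the sum of these maps over the points, hence
respects mixtures. -/
theorem extend_comb (hpc : ∀ p r s x, act' (RewardSpace.pc p r s) x =
    comb' p (act' r x) (act' s x)) (p : Prob) (a b : T2 R X) :
    extend act' comb' f (comb p a b) = comb' p (extend act' comb' f a) (extend act' comb' f b) := by
  classical
  have hφ := BaryCone.isConeMap h.barycentric
  have hψ : ∀ x, IsConeMap RewardSpace.pc
      fun w r => BaryCone.mk h.barycentric w (act' r (f x)) := fun x =>
    hφ.comp (h := fun r => act' r (f x)) fun p r s => hpc p r s (f x)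
  have key : ∀ {c : ℝ} (_ : 0 ≤ c) (a : T2 R X) (S : Finset X), a.dist.weights.support ⊆ S →
      BaryCone.mk h.barycentric c (extend act' comb' f a) =
        ∑ x ∈ S, BaryCone.lift _ (hψ x) (toCone c a x) := by
    intro c hc a S hS
    rw [extend, hφ.convexSum hc _ _ hS]
    exact Finset.sum_congr rfl fun x _ =>
      (BaryCone.lift_mk _ (hψ x) (mul_nonneg hc (a.dist.nonneg x)) _).symm
  have hp : (0 : ℝ) ≤ 1 * p := by simpa using p.2.1
  have hp' : (0 : ℝ) ≤ 1 * (1 - p) := by simpa using p.2.2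
  apply BaryCone.mk_injective (h := h.barycentric) zero_lt_one
  rw [hφ.comb _ _ _ _ zero_le_one, key hp a _ Finset.subset_union_left,
    key hp' b _ Finset.subset_union_right,
    key zero_le_one (comb p a b) _ (support_mix_subset p a.dist b.dist),
    ← Finset.sum_add_distrib, (isConeMap_toCone X).comb _ _ _ _ zero_le_one]
  exact Finset.sum_congr rfl fun x _ => map_add _ _ _

end Extend

theorem ofFun_mix {X : Type u} (p : Prob) (μ ν : StdSimplex ℝ X) (ρ : X → R) :
    ofFun (mix p μ ν) ρ = comb p (ofFun μ ρ) (ofFun ν ρ) := by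
  apply toCone_injective X
  rw [(isConeMap_toCone X).comb _ _ _ _ zero_le_one, toCone_ofFun, toCone_ofFun, toCone_ofFun]
  funext x
  have hμ : 0 ≤ μ.weights x := μ.nonneg x
  have hν : 0 ≤ ν.weights x := ν.nonneg x
  have hp : (0 : ℝ) ≤ p := p.2.1
  have hp' : (0 : ℝ) ≤ 1 - p := sub_nonneg.2 p.2.2
  simp only [Pi.add_apply, one_mul]
  rw [← (BaryCone.isConeMap _).add _ _ _ (mul_nonneg hp hμ) (mul_nonneg hp' hν), weights_mix]
  rfl

theorem ofFun_single {X : Type u} (x : X) (ρ : X → R) :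
    ofFun (StdSimplex.single x) ρ = act (ρ x) (unit R x) := by
  apply toCone_injective X
  rw [toCone_ofFun, toCone_act]
  funext y
  by_cases h : x = y
  · subst h
    simp [unit, ofFun]
  · simp [unit, ofFun, h, BaryCone.mk_zero]

theorem isFree : (T2.aux R).IsFree T2.act T2.comb where
  isModule := isModule
  pure_bind x f := extend_unit (isModule _) f x
  act_bind r a f := extend_act (isModule _) f r a
  comb_bind p a b f := extend_comb (isModule _) f pc_act p a b
  induction {X P} hpure hact hcomb a := by
    rw [← ofFun_rew a]
    -- A reward function on all of `X` can be kept fixed while the distribution is decomposed into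
    -- point masses, as `ofFun` truncates it afresh to each support.
    generalize a.dist = μ
    generalize a.rew = ρ
    induction μ using stdSimplex_induction with
    | single x => rw [ofFun_single]; exact hact _ _ (hpure x)
    | mix p μ ν hμ hν => rw [ofFun_mix]; exact hcomb _ _ _ hμ hν
  genReward_eq r := rfl
  genProb_eq p := rfl
  alg_pure r := extend_unit RewardSpace.isModule id r
  alg_act r x := extend_act RewardSpace.isModule id r x
  alg_comb p x y := extend_comb RewardSpace.isModule id
    (fun p r s x => by simp only [add_comm _ x, RewardSpace.add_pc]) p x y

theorem lawfulMonad : LawfulMonad (T2 R) :=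
  .mk' _ (fun a => isFree.bind_pure a) (fun x f => isFree.pure_bind x f)
    (fun a f g => isFree.bind_assoc a f g)

end T2

/-! ### Distributions with one reward -/

namespace T3

theorem isModule (X : Type u) : IsBarycentricModule R (A := T3 R X) act comb where
  barycentric :=
    { comb_one _ _ := T3.ext ((isBarycentric_mix X).comb_one _ _)
        (RewardSpace.barycentric.comb_one _ _)
      comb_self _ _ := T3.ext ((isBarycentric_mix X).comb_self _ _)
        (RewardSpace.barycentric.comb_self _ _)
      comb_symm _ _ _ := T3.ext ((isBarycentric_mix X).comb_symm _ _ _)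
        (RewardSpace.barycentric.comb_symm _ _ _)
      comb_assoc p q s _ _ _ hp hq hs :=
        T3.ext ((isBarycentric_mix X).comb_assoc p q s _ _ _ hp hq hs)
          (RewardSpace.barycentric.comb_assoc p q s _ _ _ hp hq hs) }
  zero_act _ := T3.ext rfl (zero_add _)
  act_act _ _ _ := T3.ext rfl (add_assoc _ _ _).symm
  act_comb _ _ _ _ := T3.ext rfl (RewardSpace.add_pc _ _ _ _)

section Extend

variable {X : Type u} {A : Type*} {act' : R → A → A} {comb' : Prob → A → A → A}
  (h : IsBarycentricModule R act' comb') (f : X → A)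

include h

theorem extend_single (x : X) : extend act' comb' f ⟨StdSimplex.single x, 0⟩ = f x := by
  rw [extend, convexSum_single h.barycentric, h.zero_act]

theorem extend_act (r : R) (a : T3 R X) :
    extend act' comb' f (act r a) = act' r (extend act' comb' f a) :=
  (h.act_act _ _ _).symm

/-- By `hg` the two rewards may be replaced by their common mean, which is then pulled out of the
combination. This is the step for which rewards must gather. -/
theorem extend_comb (hg : ∀ p r s x y, comb' p (act' r x) (act' s y) =
      comb' p (act' (RewardSpace.pc p r s) x) (act' (RewardSpace.pc p r s) y))
    (p : Prob) (a b : T3 R X) :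
    extend act' comb' f (comb p a b) = comb' p (extend act' comb' f a) (extend act' comb' f b) := by
  rw [extend, extend, extend, hg, ← h.act_comb, ← convexSum_mix h.barycentric]
  rfl

end Extend

theorem isFree (hR : GathersRewards R) : (T3.aux R).IsFree T3.act T3.comb where
  isModule := isModule
  pure_bind x f := extend_single (isModule _) f x
  act_bind r a f := extend_act (isModule _) f r a
  comb_bind p a b f := extend_comb (isModule _) f
    (fun p r s x y => T3.ext rfl (hR p r s x.rew y.rew)) p a b
  induction {X P} hpure hact hcomb a := by
    -- Mixing two elements of reward zero gives reward zero by idempotence, so units and mixtures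
    -- generate all elements of reward zero; a single action then sets the reward.
    have key : ∀ μ : StdSimplex ℝ X, P ⟨μ, 0⟩ := fun μ => by
      induction μ using stdSimplex_induction with
      | single x => exact hpure x
      | mix p μ ν hμ hν =>
        have := hcomb p _ _ hμ hν
        rwa [comb, RewardSpace.barycentric.comb_self] at this
    have := hact a.rew _ (key a.dist)
    rwa [act, add_zero] at this
  genReward_eq r := T3.ext rfl (add_zero r).symm
  genProb_eq p := T3.ext rfl (RewardSpace.barycentric.comb_self p 0).symm
  alg_pure r := extend_single RewardSpace.isModule id r
  alg_act r x := extend_act RewardSpace.isModule id r x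
  alg_comb p x y := extend_comb RewardSpace.isModule id (fun p r s x y => hR p r s x y) p x y

theorem lawfulMonad (hR : GathersRewards R) : LawfulMonad (T3 R) :=
  .mk' _ (fun a => (isFree hR).bind_pure a) (fun x f => (isFree hR).pure_bind x f)
    (fun a f g => (isFree hR).bind_assoc a f g)

end T3

end FreeModules

end SelLang

theorem mainTheorem2 {V : Vocabulary.{v}} (ev : FnEval V) {R : Type u} [RewardSpace R]
    (I : Interpretation V ev R) :
    -- every program `M` has exactly one effect value `Op(M)`
    (∀ {σ : Ty V.B} (M : Program V σ), ∃! E : EffVal V σ, Evaluates ev M E) ∧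
    -- selection adequacy, for every auxiliary monad
    (∀ (T : Type u → Type u) [Monad T] [LawfulMonad T] (A : AuxData R T), A.IsAuxiliary →
      ∀ {σ : Ty V.B} (M : Program V σ) (E : EffVal V σ), Evaluates ev M E →
        I.denP A M (fun _ => 0) = I.denDW A (I.opS E)) ∧
    -- the three auxiliary monads
    (LawfulMonad (T1 R) ∧ (T1.aux R).IsAuxiliary) ∧
    (LawfulMonad (T2 R) ∧ (T2.aux R).IsAuxiliary) ∧
    (GathersRewards R → LawfulMonad (T3 R) ∧ (T3.aux R).IsAuxiliary) := by
  have hb := I.eq_tt_or_ff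
  have htf := I.tt_ne_ff
  refine ⟨fun M => existsUnique_evaluates hb htf M, fun T _ _ A hA σ M E hE => ?_,
    ⟨T1.lawfulMonad, ?_⟩, ⟨T2.lawfulMonad, ?_⟩, fun hR => ⟨T3.lawfulMonad hR, ?_⟩⟩
  · rw [I.denP_eq_denEff hA hb (hE.runs ev htf), I.denEff_zero hA]
  · have := T1.lawfulMonad (R := R)
    exact T1.isFree.isAuxiliary
  · have := T2.lawfulMonad (R := R)
    exact T2.isFree.isAuxiliary
  · have := T3.lawfulMonad hR
    exact (T3.isFree hR).isAuxiliary
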